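/- Let $\alpha\in(-1,0)$ and write $\mathbb{R}^2_+=\{x=(x_1,x_2)\in\mathbb{R}^2: x_2>0\}$, $B_1^+=\{x\in\mathbb{R}^2_+:|x|<1\}$, and $d\nu=\cos^\alpha\theta\,d\theta$ on $(-\frac{\pi}{2},\frac{\pi}{2})$. (a) (Second variation at the half-disc, $N=2$, $k=l=0$.) Let $u\in C^2\big((-\frac{\pi}{2},\frac{\pi}{2})\big)$ with $\int_{-\pi/2}^{\pi/2}u'^2\,d\nu<\infty$ (for instance $u\in C^2([-\frac{\pi}{2},\frac{\pi}{2}])$), let $s\in C^2(\mathbb{R})$ with $s(0)=0$, and put $$U(t)=\Big\{(r\sin\theta,\,r\cos\theta)\in\mathbb{R}^2_+ :\ \theta\in\big(-\tfrac{\pi}{2},\tfrac{\pi}{2}\big),\ 0\le r<1+t\,u(\theta)+s(t)\Big\}\qquad(t\in\mathbb{R}).$$ Assume that the perturbation preserves the weighted volume: there is $t_0>0$ with $\int_{U(t)}x_2^\alpha\,dx=\int_{B_1^+}x_2^\alpha\,dx$ for all $|t|<t_0$. Then the weighted perimeter $$J(t)=\int_{\partial U(t)\cap\mathbb{R}^2_+}x_2^\alpha\,\mathcal{H}_1(dx)$$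 ($\mathcal{H}_1$ the one-dimensional Hausdorff measure) is finite and differentiable for $t$ near $0$, it is twice differentiable at $0$, and $J''(0)\ge 0$. (b) (Weighted Wirtinger inequality.) Let $H^1((-\frac{\pi}{2},\frac{\pi}{2});d\nu)$ be the space of functions $\phi\in L^2(d\nu)$ whose weak derivative $\phi'$ on $(-\frac{\pi}{2},\frac{\pi}{2})$ exists and lies in $L^2(d\nu)$, and let $V$ be the set of those $\phi$ in it with $\int_{-\pi/2}^{\pi/2}\phi\,d\nu=0$. Then the minimum $$\min_{\phi\in V\setminus\{0\}}\ \frac{\int_{-\pi/2}^{\pi/2}\phi'(t)^2\cos^\alpha t\,dt}{\int_{-\pi/2}^{\pi/2}\phi(t)^2\cos^\alpha t\,dt}$$ is attained and equals $1+\alpha$. -/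

import Mathlib

open Real Set Filter Topology MeasureTheory
open scoped ContDiff ENNReal

/-- The Euclidean plane `ℝ²`; the last coordinate `x_N` is `x 1`. -/
abbrev Plane := EuclideanSpace ℝ (Fin 2)

/-- The open upper half-plane `ℝ²₊`. -/
def upperHalf : Set Plane := {x | 0 < x 1}

/-- The half-disc `B₁⁺ = B₁ ∩ ℝ²₊`. -/
def halfDisc : Set Plane := Metric.ball 0 1 ∩ upperHalf

/-- The weight `|x|^k x_N^α`, as an extended nonnegative number. It is only ever evaluated on
`ℝ²₊`, where both bases are positive. -/
noncomputable def planeWeight (k α : ℝ) (x : Plane) : ℝ≥0∞ :=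
  ENNReal.ofReal (‖x‖ ^ k * (x 1) ^ α)

/-- The weighted volume `∫_Ω |x|^l x_N^α dx` of a set `Ω ⊆ ℝ²₊`. -/
noncomputable def weightedVolume (l α : ℝ) (Ω : Set Plane) : ℝ≥0∞ :=
  ∫⁻ x in Ω ∩ upperHalf, planeWeight l α x

/-- The weighted perimeter `∫_{∂Ω} |x|^k x_N^α ℋ₁(dx)` relative to `ℝ²₊`: the part of the
topological boundary that lies on the line `{x_N = 0}` is not counted. -/
noncomputable def weightedPerimeter (k α : ℝ) (Ω : Set Plane) : ℝ≥0∞ :=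
  ∫⁻ x in frontier Ω ∩ upperHalf, planeWeight k α x ∂(Measure.hausdorffMeasure 1)

/-- The point with polar radius `r` and angle `θ`, measured from the positive `x_N`-axis. -/
noncomputable def polarPoint (r θ : ℝ) : Plane := !₂[r * Real.sin θ, r * Real.cos θ]

/-- The perturbed half-disc
`U(t) = {x = rθ ∈ ℝ²₊ : 0 ≤ r < 1 + t u(θ) + s(t)}`, the half-circle being parametrised by the
angle `θ ∈ (-π/2, π/2)`. -/
noncomputable def perturbedHalfDisc (u s : ℝ → ℝ) (t : ℝ) : Set Plane :=
  {x | x ∈ upperHalf ∧ ∃ r θ : ℝ, θ ∈ Ioo (-(π / 2)) (π / 2) ∧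
    0 ≤ r ∧ r < 1 + t * u θ + s t ∧ x = polarPoint r θ}

/-- The measure `dν = cos^α t dt` on `(-π/2, π/2)`. -/
noncomputable def cosMeasure (α : ℝ) : Measure ℝ :=
  (volume.restrict (Ioo (-(π / 2)) (π / 2))).withDensity
    fun t => ENNReal.ofReal (Real.cos t ^ α)

/-- `ψ` is a weak derivative of `φ` on the interval `(a, b)`. -/
def IsWeakDerivOn (φ ψ : ℝ → ℝ) (a b : ℝ) : Prop :=
  LocallyIntegrableOn φ (Ioo a b) ∧ LocallyIntegrableOn ψ (Ioo a b) ∧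
    ∀ η : ℝ → ℝ, ContDiff ℝ ∞ η → HasCompactSupport η → tsupport η ⊆ Ioo a b →
      ∫ t in Ioo a b, φ t * deriv η t = -∫ t in Ioo a b, ψ t * η t

/-- `φ` belongs to the weighted Sobolev space `H¹((-π/2, π/2); dν)` and `ψ` is its weak
derivative `φ'`. -/
def MemWeightedH1 (α : ℝ) (φ ψ : ℝ → ℝ) : Prop :=
  MemLp φ 2 (cosMeasure α) ∧ MemLp ψ 2 (cosMeasure α) ∧
    IsWeakDerivOn φ ψ (-(π / 2)) (π / 2)

/-- The set of the values of the Rayleigh quotient `Q(φ) = ∫ φ'² dν / ∫ φ² dν` over the nonzero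
`φ ∈ H¹((-π/2, π/2); dν)` with `∫ φ dν = 0`. -/
def rayleighValues (α : ℝ) : Set ℝ :=
  {q | ∃ φ ψ : ℝ → ℝ, MemWeightedH1 α φ ψ ∧ ∫ t, φ t ∂(cosMeasure α) = 0 ∧
    ¬ φ =ᵐ[cosMeasure α] 0 ∧
    q = (∫ t, ψ t ^ 2 ∂(cosMeasure α)) / ∫ t, φ t ^ 2 ∂(cosMeasure α)}

/-- The functional `J(t) = ∫_{∂U(t)} |x|^k x_N^α ℋ₁(dx)`. -/
noncomputable def perimeterFunctional (k α : ℝ) (u s : ℝ → ℝ) (t : ℝ) : ℝ :=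
  (weightedPerimeter k α (perturbedHalfDisc u s t)).toReal

/-! In polar coordinates `U(t)` is the region below the graph `r = ρ(θ)` with `ρ = 1 + t u + s(t)`.
Its weighted perimeter is `∫ ρ^α √(ρ² + ρ_θ²) dν` (`weightedPerimeter_polarSubgraph`) and its
weighted volume is `∫ ρ^(2+α)/(2+α) dν` (`weightedVolume_polarSubgraph`). Put `v = u + s'(0)` and
let `m` be the total mass of `ν`. Differentiating the constant volume once and twice at `t = 0`
gives `∫ v dν = 0` and `m s''(0) = -(1+α) ∫ v² dν`. Substituted into the second derivative of the
perimeter, this leaves `J''(0) = ∫ u'² dν - (1+α) ∫ v² dν`. Since `v' = u'`, part (a) is the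
Wirtinger inequality of part (b) applied to `v`.

The Wirtinger inequality (`weighted_wirtinger`) comes from a dual problem. If `φ` has mean zero,
then `F(x) = ∫_{-π/2}^x φ dν` vanishes at both ends, and integration by parts gives `∫ φ² dν = -∫ φ'
F dx`. The positive function `cos^(1+α)` solves `-(cos^(-α) F')' = (1+α) cos^(-α) F`, which yields
the Hardy type bound `(1+α) ∫ F² cos^(-α) ≤ ∫ φ² dν` (`integral_sq_mul_cos_rpow_neg_le`). Completing
the square in `φ' + (1+α) cos^(-α) F` finishes the proof. For `φ = sin` this expression vanishes and
`F` is a multiple of `cos^(1+α)`, so the constant is attained.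

Three tools link this to the definitions. The du Bois-Reymond lemma replaces a Sobolev function by a
primitive of its weak derivative. The area formula turns the Hausdorff integral into an integral
over angles. Bounds of the form `K (1 + u'²)` justify differentiating twice under the integral. -/

/-! ### The weight `cos^α` and the measure `dν`. -/

theorem cos_pos_of_mem_halfPi {x : ℝ} (hx : x ∈ Ioo (-(π / 2)) (π / 2)) : 0 < Real.cos x :=
  Real.cos_pos_of_mem_Ioo hx

theorem hasDerivAt_cos_rpow {x : ℝ} (hx : x ∈ Ioo (-(π / 2)) (π / 2)) (p : ℝ) :
    HasDerivAt (fun y => Real.cos y ^ p) (-(p * Real.cos x ^ (p - 1) * Real.sin x)) x := by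
  have h := (Real.hasDerivAt_cos x).rpow_const (p := p) (Or.inl (cos_pos_of_mem_halfPi hx).ne')
  convert h using 1
  ring

theorem one_le_cos_rpow {α : ℝ} (hα : α ∈ Ioo (-1 : ℝ) 0) {x : ℝ}
    (hx : x ∈ Ioo (-(π / 2)) (π / 2)) : 1 ≤ Real.cos x ^ α :=
  Real.one_le_rpow_of_pos_of_le_one_of_nonpos (cos_pos_of_mem_halfPi hx) (Real.cos_le_one x)
    hα.2.le

/-- The derivative of `cos^{1+α} sin`. -/
theorem hasDerivAt_cos_rpow_mul_sin (α : ℝ) {x : ℝ} (hx : x ∈ Ioo (-(π / 2)) (π / 2)) :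
    HasDerivAt (fun y => Real.cos y ^ (1 + α) * Real.sin y)
      (Real.cos x ^ α * (Real.cos x ^ 2 - (1 + α) * Real.sin x ^ 2)) x := by
  refine ((hasDerivAt_cos_rpow hx (1 + α)).mul (Real.hasDerivAt_sin x)).congr_deriv ?_
  have hc := cos_pos_of_mem_halfPi hx
  rw [Real.rpow_add hc, Real.rpow_one, add_sub_cancel_left]
  ring

/-- The function `(2+α) x - cos^(1+α) x sin x` is continuous up to the endpoints. Its derivative
equals `(2+α)(1 - cos^(2+α)) + (1+α) cos^α`, which is nonnegative, hence integrable, and dominates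
`(1+α) cos^α`. -/
theorem intervalIntegrable_cos_rpow {α : ℝ} (hα : α ∈ Ioo (-1 : ℝ) 0) :
    IntervalIntegrable (fun x => Real.cos x ^ α) volume (-(π / 2)) (π / 2) := by
  have hpi := Real.pi_pos
  have hle : -(π / 2) ≤ π / 2 := by linarith
  have h1 : 0 < 1 + α := by linarith [hα.1]
  have key : IntegrableOn (fun x => (2 + α) -
      Real.cos x ^ α * (Real.cos x ^ 2 - (1 + α) * Real.sin x ^ 2)) (Ioc (-(π / 2)) (π / 2)) := by
    refine intervalIntegral.integrableOn_deriv_of_nonneg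
      (g := fun x => (2 + α) * x - Real.cos x ^ (1 + α) * Real.sin x) ?_ ?_ ?_
    · exact ((continuous_const.mul continuous_id).sub
        ((Real.continuous_cos.rpow_const fun _ => Or.inr h1.le).mul
          Real.continuous_sin)).continuousOn
    · intro x hx
      exact (((hasDerivAt_id x).const_mul (2 + α)).sub
        (hasDerivAt_cos_rpow_mul_sin α hx)).congr_deriv (by simp)
    · intro x hx
      have hc := cos_pos_of_mem_halfPi hx
      have hle : Real.cos x ^ α * Real.cos x ^ 2 ≤ 1 := by
        rw [← Real.rpow_natCast, ← Real.rpow_add hc]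
        exact Real.rpow_le_one hc.le (Real.cos_le_one x) (by push_cast; linarith)
      have hp : 0 ≤ Real.cos x ^ α * ((1 + α) * Real.sin x ^ 2) := by positivity
      nlinarith
  rw [intervalIntegrable_iff_integrableOn_Ioo_of_le hle]
  replace key := (key.mono_set Ioo_subset_Ioc_self).const_mul (1 + α)⁻¹
  refine Integrable.mono' key ?_ ?_
  · exact (Real.continuous_cos.measurable.pow_const α).aestronglyMeasurable
  · refine (ae_restrict_iff' measurableSet_Ioo).2 (ae_of_all _ fun x hx => ?_)
    have hc := cos_pos_of_mem_halfPi hx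
    have hle : Real.cos x ^ α * Real.cos x ^ 2 ≤ 1 := by
      rw [← Real.rpow_natCast, ← Real.rpow_add hc]
      exact Real.rpow_le_one hc.le (Real.cos_le_one x) (by push_cast; linarith)
    rw [Real.norm_of_nonneg (by positivity), Real.sin_sq, ← div_eq_inv_mul, le_div_iff₀ h1]
    nlinarith

theorem cosMeasure_eq (α : ℝ) : cosMeasure α =
    (volume.restrict (Ioo (-(π / 2)) (π / 2))).withDensity
      fun t => ((Real.cos t ^ α).toNNReal : ℝ≥0∞) := rfl

theorem measurable_toNNReal_cos_rpow (α : ℝ) :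
    Measurable fun t : ℝ => (Real.cos t ^ α).toNNReal :=
  (Real.continuous_cos.measurable.pow_const α).real_toNNReal

theorem integral_cosMeasure (α : ℝ) (f : ℝ → ℝ) :
    ∫ t, f t ∂(cosMeasure α) = ∫ t in (-(π / 2))..(π / 2), Real.cos t ^ α * f t := by
  have hle : -(π / 2) ≤ π / 2 := by linarith [Real.pi_pos]
  rw [cosMeasure_eq, integral_withDensity_eq_integral_smul (measurable_toNNReal_cos_rpow α),
    intervalIntegral.integral_of_le hle, integral_Ioc_eq_integral_Ioo]
  refine setIntegral_congr_fun measurableSet_Ioo fun t ht => ?_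
  have := cos_pos_of_mem_halfPi ht
  simp [NNReal.smul_def, Real.coe_toNNReal _ (Real.rpow_nonneg this.le α)]

theorem integrable_cosMeasure_iff (α : ℝ) (f : ℝ → ℝ) : Integrable f (cosMeasure α) ↔
    IntervalIntegrable (fun t => Real.cos t ^ α * f t) volume (-(π / 2)) (π / 2) := by
  have hle : -(π / 2) ≤ π / 2 := by linarith [Real.pi_pos]
  rw [cosMeasure_eq, integrable_withDensity_iff_integrable_smul (measurable_toNNReal_cos_rpow α),
    intervalIntegrable_iff_integrableOn_Ioo_of_le hle]
  refine integrable_congr ((ae_restrict_iff' measurableSet_Ioo).2 (ae_of_all _ fun t ht => ?_))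
  have := cos_pos_of_mem_halfPi ht
  simp [NNReal.smul_def, Real.coe_toNNReal _ (Real.rpow_nonneg this.le α)]

theorem ae_cosMeasure_iff (α : ℝ) {p : ℝ → Prop} :
    (∀ᵐ t ∂(cosMeasure α), p t) ↔ ∀ᵐ t, t ∈ Ioo (-(π / 2)) (π / 2) → p t := by
  rw [cosMeasure_eq, ae_withDensity_iff (measurable_toNNReal_cos_rpow α).coe_nnreal_ennreal,
    ae_restrict_iff' measurableSet_Ioo]
  refine eventually_congr (ae_of_all _ fun t => forall_congr' fun ht => ?_)
  have := Real.rpow_pos_of_pos (cos_pos_of_mem_halfPi ht) α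
  simp [this]

/-- The density is positive on the open interval. This direction carries measurability from `ν` back
to Lebesgue measure. -/
theorem restrict_absolutelyContinuous_cosMeasure (α : ℝ) :
    volume.restrict (Ioo (-(π / 2)) (π / 2)) ≪ cosMeasure α := by
  refine Measure.AbsolutelyContinuous.mk fun s _ h => ?_
  rw [measure_eq_zero_iff_ae_notMem] at h ⊢
  rw [ae_cosMeasure_iff] at h
  rwa [ae_restrict_iff' measurableSet_Ioo]

theorem cosMeasure_absolutelyContinuous (α : ℝ) :
    cosMeasure α ≪ volume.restrict (Ioo (-(π / 2)) (π / 2)) :=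
  withDensity_absolutelyContinuous _ _

theorem isFiniteMeasure_cosMeasure {α : ℝ} (hα : α ∈ Ioo (-1 : ℝ) 0) :
    IsFiniteMeasure (cosMeasure α) := by
  have : Integrable (fun _ : ℝ => (1 : ℝ)) (cosMeasure α) := by
    rw [integrable_cosMeasure_iff]
    simpa using intervalIntegrable_cos_rpow hα
  simpa [integrable_const_iff] using this

/-- Functions in `L²(dν)` are integrable with respect to Lebesgue measure. -/
theorem intervalIntegrable_of_memLp_cosMeasure {α : ℝ} (hα : α ∈ Ioo (-1 : ℝ) 0) {ψ : ℝ → ℝ}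
    (hψ : MemLp ψ 2 (cosMeasure α)) :
    IntervalIntegrable ψ volume (-(π / 2)) (π / 2) := by
  have hle : -(π / 2) ≤ π / 2 := by linarith [Real.pi_pos]
  have h2 := (integrable_cosMeasure_iff _ _).1 hψ.integrable_sq
  rw [intervalIntegrable_iff_integrableOn_Ioo_of_le hle] at h2 ⊢
  refine Integrable.mono' ((integrable_const (1 : ℝ)).add h2)
    (hψ.1.mono_ac (restrict_absolutelyContinuous_cosMeasure α)) ?_
  refine (ae_restrict_iff' measurableSet_Ioo).2 (ae_of_all _ fun x hx => ?_)
  -- Because `cos^α ≥ 1`, one has `|ψ| ≤ 1 + ψ² ≤ 1 + cos^α ψ²`.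
  have h1 := one_le_cos_rpow hα hx
  simp only [Pi.add_apply, Real.norm_eq_abs]
  have := sq_abs (ψ x)
  nlinarith [sq_nonneg (|ψ x| - 1), sq_nonneg (ψ x), abs_nonneg (ψ x)]

/-! ### The Hardy type inequality and the weighted Wirtinger inequality. -/

/-- A barrier: the primitive of a function bounded by `M cos^α` that vanishes at `π/2` is
controlled by `cos^{1+α}`. -/
theorem abs_le_cos_rpow_of_deriv_le {α : ℝ} (hα : α ∈ Ioo (-1 : ℝ) 0) {F f : ℝ → ℝ} {M : ℝ}
    (hF : ContinuousOn F (Icc 0 (π / 2))) (hd : ∀ x ∈ Ioo 0 (π / 2), HasDerivAt F (f x) x)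
    (hf : ∀ x ∈ Ioo 0 (π / 2), |f x| ≤ M * Real.cos x ^ α) (h0 : F (π / 2) = 0)
    {x : ℝ} (hx : x ∈ Icc 0 (π / 2)) : |F x| ≤ 2 * M / (1 + α) * Real.cos x ^ (1 + α) := by
  have hpi := Real.pi_pos
  have h1 : 0 < 1 + α := by linarith [hα.1]
  have hM : 0 ≤ M := by
    have hm : π / 4 ∈ Ioo 0 (π / 2) := ⟨by linarith, by linarith⟩
    have hc := Real.rpow_pos_of_pos
      (Real.cos_pos_of_mem_Ioo (x := π / 4) ⟨by linarith, by linarith⟩) α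
    exact nonneg_of_mul_nonneg_left ((abs_nonneg _).trans (hf _ hm)) hc
  have barrier : ∀ σ : ℝ, |σ| = 1 →
      σ * F x ≤ M / (1 + α) * (Real.cos x ^ (1 + α) * (2 - Real.sin x)) := by
    intro σ hσ
    -- The derivative of `cos^(1+α)` alone degenerates at `0`, where `sin` vanishes. The factor `2 -
    -- sin`, which lies in `[1, 2]` here, makes the barrier decrease at least at the rate `M cos^α`
    -- throughout.
    let G : ℝ → ℝ := fun y =>
      M / (1 + α) * (Real.cos y ^ (1 + α) * (2 - Real.sin y)) - σ * F y
    have hG : AntitoneOn G (Icc 0 (π / 2)) := by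
      have hder : ∀ y ∈ Ioo 0 (π / 2), HasDerivAt G (M / (1 + α) *
          (-((1 + α) * Real.cos y ^ (1 + α - 1) * Real.sin y) * (2 - Real.sin y) +
            Real.cos y ^ (1 + α) * (-Real.cos y)) - σ * f y) y := fun y hy =>
        (((hasDerivAt_cos_rpow ⟨by linarith [hy.1], hy.2⟩ (1 + α)).mul
          ((Real.hasDerivAt_sin y).const_sub 2)).const_mul _).sub ((hd y hy).const_mul σ)
      refine antitoneOn_of_deriv_nonpos (convex_Icc _ _) ?_ ?_ ?_
      · exact ((continuous_const.mul ((Real.continuous_cos.rpow_const fun _ => Or.inr h1.le).mul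
          (continuous_const.sub Real.continuous_sin))).continuousOn).sub
          (continuousOn_const.mul hF)
      · rw [interior_Icc]
        exact fun y hy => (hder y hy).differentiableAt.differentiableWithinAt
      · rw [interior_Icc]
        intro y hy
        rw [(hder y hy).deriv]
        have hc : 0 < Real.cos y := Real.cos_pos_of_mem_Ioo ⟨by linarith [hy.1], hy.2⟩
        have hs : 0 < Real.sin y := Real.sin_pos_of_mem_Ioo ⟨hy.1, by linarith [hy.2]⟩
        have hs1 := Real.sin_le_one y
        have hσf : -(σ * f y) ≤ M * Real.cos y ^ α := by
          refine (neg_le_abs _).trans ?_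
          rw [abs_mul, hσ, one_mul]
          exact hf y hy
        have hP := Real.rpow_pos_of_pos hc α
        have hid : M / (1 + α) *
          (-((1 + α) * Real.cos y ^ (1 + α - 1) * Real.sin y) * (2 - Real.sin y) +
            Real.cos y ^ (1 + α) * (-Real.cos y)) = - (M * Real.cos y ^ α) -
            M / (1 + α) * Real.cos y ^ α *
              ((1 - Real.sin y) * ((1 + α) * Real.sin y + Real.sin y) -
                α * (1 - Real.sin y)) := by
          rw [add_sub_cancel_left, Real.rpow_add hc, Real.rpow_one]
          field_simp
          have := Real.sin_sq_add_cos_sq y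
          linear_combination (-M) * this
        have hrest : 0 ≤ M / (1 + α) * Real.cos y ^ α *
              ((1 - Real.sin y) * ((1 + α) * Real.sin y + Real.sin y) -
                α * (1 - Real.sin y)) := by
          have h3 : 0 ≤ 1 - Real.sin y := by linarith
          have h4 : 0 ≤ -α * (1 - Real.sin y) := mul_nonneg (by linarith [hα.2]) h3
          have h5 : 0 ≤ (1 - Real.sin y) * ((1 + α) * Real.sin y + Real.sin y) := by positivity
          refine mul_nonneg (by positivity) (by linarith)
        rw [hid]
        linarith
    have := hG hx (right_mem_Icc.2 (by linarith)) hx.2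
    simp only [G, Real.cos_pi_div_two, h0, Real.zero_rpow h1.ne'] at this
    linarith
  have h6 : |F x| ≤ M / (1 + α) * (Real.cos x ^ (1 + α) * (2 - Real.sin x)) := by
    refine abs_le.2 ⟨?_, ?_⟩
    · linarith [barrier (-1) (by simp)]
    · linarith [barrier 1 (by simp)]
  have hs : 0 ≤ Real.sin x := Real.sin_nonneg_of_mem_Icc ⟨hx.1, by linarith [hx.2]⟩
  have hc : 0 ≤ Real.cos x := Real.cos_nonneg_of_mem_Icc ⟨by linarith [hx.1], hx.2⟩
  have h7 : 0 ≤ M / (1 + α) * Real.cos x ^ (1 + α) := by positivity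
  calc |F x| ≤ _ := h6
    _ = M / (1 + α) * Real.cos x ^ (1 + α) * (2 - Real.sin x) := by ring
    _ ≤ M / (1 + α) * Real.cos x ^ (1 + α) * 2 := mul_le_mul_of_nonneg_left (by linarith) h7
    _ = _ := by ring

theorem abs_le_cos_rpow_of_deriv_le_of_symm {α : ℝ} (hα : α ∈ Ioo (-1 : ℝ) 0)
    {F f : ℝ → ℝ} {M : ℝ} (hF : ContinuousOn F (Icc (-(π / 2)) (π / 2)))
    (hd : ∀ x ∈ Ioo (-(π / 2)) (π / 2), HasDerivAt F (f x) x)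
    (hf : ∀ x ∈ Ioo (-(π / 2)) (π / 2), |f x| ≤ M * Real.cos x ^ α)
    (hl : F (-(π / 2)) = 0) (hr : F (π / 2) = 0)
    {x : ℝ} (hx : x ∈ Icc (-(π / 2)) (π / 2)) :
    |F x| ≤ 2 * M / (1 + α) * Real.cos x ^ (1 + α) := by
  have hpi := Real.pi_pos
  rcases le_total 0 x with h | h
  · refine abs_le_cos_rpow_of_deriv_le hα (hF.mono (Icc_subset_Icc_left (by linarith)))
      (fun y hy => hd y ⟨by linarith [hy.1], hy.2⟩) (fun y hy => hf y ⟨by linarith [hy.1], hy.2⟩)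
      hr ⟨h, hx.2⟩
  · have := abs_le_cos_rpow_of_deriv_le hα (F := fun y => F (-y)) (f := fun y => -f (-y)) (M := M)
      (x := -x) ?_ ?_ ?_ hl ⟨by linarith, by linarith [hx.1]⟩
    · simpa using this
    · exact hF.comp continuous_neg.continuousOn fun y hy =>
        ⟨by linarith [hy.2], by linarith [hy.1]⟩
    · intro y hy
      have h2 := hd (-y) ⟨by linarith [hy.2], by linarith [hy.1]⟩
      exact (HasDerivAt.scomp y h2 (hasDerivAt_neg y)).congr_deriv (by simp)
    · intro y hy
      simpa using hf (-y) ⟨by linarith [hy.2], by linarith [hy.1]⟩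

/-- One-dimensional Hardy type inequality for the weight `cos^{-α}`, with ground state
`cos^{1+α}`. -/
theorem integral_sq_mul_cos_rpow_neg_le {α : ℝ} (hα : α ∈ Ioo (-1 : ℝ) 0)
    {F φ : ℝ → ℝ} {M : ℝ} (hF : ContinuousOn F (Icc (-(π / 2)) (π / 2)))
    (hd : ∀ x ∈ Ioo (-(π / 2)) (π / 2), HasDerivAt F (Real.cos x ^ α * φ x) x)
    (hφ : ∀ x ∈ Ioo (-(π / 2)) (π / 2), |φ x| ≤ M)
    (hi : IntervalIntegrable (fun x => Real.cos x ^ α * φ x ^ 2) volume (-(π / 2)) (π / 2))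
    (hl : F (-(π / 2)) = 0) (hr : F (π / 2) = 0) :
    (1 + α) * ∫ x in (-(π / 2))..(π / 2), F x ^ 2 * Real.cos x ^ (-α) ≤
      ∫ x in (-(π / 2))..(π / 2), Real.cos x ^ α * φ x ^ 2 := by
  have hpi := Real.pi_pos
  have hle : -(π / 2) ≤ π / 2 := by linarith
  have h1 : 0 < 1 + α := by linarith [hα.1]
  have hb : ∀ x ∈ Icc (-(π / 2)) (π / 2), |F x| ≤ 2 * M / (1 + α) * Real.cos x ^ (1 + α) := by
    intro x hx
    refine abs_le_cos_rpow_of_deriv_le_of_symm hα hF hd (fun y hy => ?_) hl hr hx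
    have hP := Real.rpow_pos_of_pos (cos_pos_of_mem_halfPi hy) α
    rw [abs_mul, abs_of_pos hP, mul_comm]
    exact mul_le_mul_of_nonneg_right (hφ y hy) hP.le
  -- `K = F² tan / cos^α` is the boundary term obtained by completing the square around the ground
  -- state: `F' + (1+α) F tan` vanishes for `F = cos^(1+α)`.
  let K : ℝ → ℝ := fun x => Real.cos x ^ (-(1 + α)) * Real.sin x * F x ^ 2
  have hKd : ∀ x ∈ Ioo (-(π / 2)) (π / 2), HasDerivAt K
      (Real.cos x ^ (-α) * (Real.cos x ^ α * φ x + (1 + α) * (F x * Real.tan x)) ^ 2 * (1 + α)⁻¹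
        - (1 + α)⁻¹ * (Real.cos x ^ α * φ x ^ 2) + F x ^ 2 * Real.cos x ^ (-α)) x := by
    intro x hx
    have hc := cos_pos_of_mem_halfPi hx
    have h := ((hasDerivAt_cos_rpow hx (-(1 + α))).mul (Real.hasDerivAt_sin x)).mul
      ((hd x hx).pow 2)
    refine h.congr_deriv ?_
    have e1 : Real.cos x ^ (-(1 + α)) = Real.cos x ^ (-α) / Real.cos x := by
      rw [← Real.rpow_sub_one hc.ne']; congr 1; ring
    have e2 : Real.cos x ^ (-(1 + α) - 1) = Real.cos x ^ (-α) / Real.cos x / Real.cos x := by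
      rw [Real.rpow_sub_one hc.ne', e1]
    have e3 : Real.cos x ^ α = (Real.cos x ^ (-α))⁻¹ := by
      rw [Real.rpow_neg hc.le, inv_inv]
    have hP := Real.rpow_pos_of_pos hc (-α)
    rw [e1, e2, e3, Real.tan_eq_sin_div_cos]
    simp only [Pi.mul_apply, Pi.pow_apply, e1]
    field_simp
    ring
  -- The singular factor `cos^(-(1+α))` is harmless at the endpoints: the barrier gives `F² =
  -- O(cos^(2+2α))`, hence `K = O(cos^(1+α))`.
  have hKc : ContinuousOn K (Icc (-(π / 2)) (π / 2)) := by
    have hend : ∀ x ∈ Icc (-(π / 2)) (π / 2), Real.cos x = 0 → ContinuousWithinAt K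
        (Icc (-(π / 2)) (π / 2)) x := by
      intro x hx hc0
      have hK0 : K x = 0 := by
        have : F x = 0 := by
          have := hb x hx
          rw [hc0, Real.zero_rpow h1.ne', mul_zero] at this
          exact abs_eq_zero.1 (le_antisymm this (abs_nonneg _))
        simp [K, this]
      rw [ContinuousWithinAt, hK0]
      refine squeeze_zero_norm' (a := fun y => (2 * M / (1 + α)) ^ 2 * Real.cos y ^ (1 + α)) ?_ ?_
      · filter_upwards [self_mem_nhdsWithin] with y hy
        have hc : 0 ≤ Real.cos y := Real.cos_nonneg_of_mem_Icc hy
        have hF2 : F y ^ 2 ≤ (2 * M / (1 + α)) ^ 2 * (Real.cos y ^ (1 + α)) ^ 2 := by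
          rw [← sq_abs, ← mul_pow]
          exact pow_le_pow_left₀ (abs_nonneg _) (hb y hy) 2
        have hP : 0 ≤ Real.cos y ^ (-(1 + α)) := Real.rpow_nonneg hc _
        have hs := Real.abs_sin_le_one y
        calc ‖K y‖ = Real.cos y ^ (-(1 + α)) * |Real.sin y| * F y ^ 2 := by
              simp only [K, norm_mul, Real.norm_eq_abs, abs_of_nonneg hP, norm_pow, sq_abs]
          _ ≤ Real.cos y ^ (-(1 + α)) * 1 *
              ((2 * M / (1 + α)) ^ 2 * (Real.cos y ^ (1 + α)) ^ 2) := by gcongr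
          _ ≤ _ := by
            rcases hc.eq_or_lt with h | h
            · simp [← h, Real.zero_rpow h1.ne']
            · have hQ := Real.rpow_pos_of_pos h (1 + α)
              rw [Real.rpow_neg hc]
              field_simp
              exact le_rfl
      · have : Tendsto (fun y => (2 * M / (1 + α)) ^ 2 * Real.cos y ^ (1 + α)) (𝓝 x)
            (𝓝 ((2 * M / (1 + α)) ^ 2 * Real.cos x ^ (1 + α))) :=
          (continuous_const.mul
            (Real.continuous_cos.rpow_const fun _ => Or.inr h1.le)).continuousAt
        rw [hc0, Real.zero_rpow h1.ne', mul_zero] at this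
        exact this.mono_left nhdsWithin_le_nhds
    intro x hx
    by_cases hxi : x ∈ Ioo (-(π / 2)) (π / 2)
    · exact (hKd x hxi).continuousAt.continuousWithinAt
    · refine hend x hx ?_
      have : x = -(π / 2) ∨ x = π / 2 := by
        by_contra! h
        exact hxi ⟨lt_of_le_of_ne hx.1 h.1.symm, lt_of_le_of_ne hx.2 h.2⟩
      rcases this with rfl | rfl <;> simp
  have hF2 : IntervalIntegrable (fun x => F x ^ 2 * Real.cos x ^ (-α)) volume
      (-(π / 2)) (π / 2) := by
    refine ContinuousOn.intervalIntegrable ?_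
    rw [uIcc_of_le hle]
    exact (hF.pow 2).mul (Real.continuous_cos.rpow_const fun _ =>
      Or.inr (by linarith [hα.2])).continuousOn
  have := intervalIntegral.sub_le_integral_of_hasDeriv_right_of_le hle
    (g := fun x => -K x) hKc.neg (fun x hx => (hKd x hx).neg.hasDerivWithinAt)
    (φ := fun x => (1 + α)⁻¹ * (Real.cos x ^ α * φ x ^ 2) - F x ^ 2 * Real.cos x ^ (-α))
    ?_ ?_
  · rw [intervalIntegral.integral_sub (hi.const_mul _) hF2, intervalIntegral.integral_const_mul]
      at this
    simp only [K, hl, hr] at this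
    have h2 := mul_le_mul_of_nonneg_left (a := 1 + α) (b := ∫ x in (-(π / 2))..(π / 2),
      F x ^ 2 * Real.cos x ^ (-α)) (by norm_num at this; exact this) h1.le
    rwa [mul_inv_cancel_left₀ h1.ne'] at h2
  · rw [integrableOn_Icc_iff_integrableOn_Ioc]
    rw [← intervalIntegrable_iff_integrableOn_Ioc_of_le hle]
    exact (hi.const_mul _).sub hF2
  · intro x hx
    have hP := Real.rpow_pos_of_pos (cos_pos_of_mem_halfPi hx) (-α)
    have : 0 ≤ Real.cos x ^ (-α) *
      (Real.cos x ^ α * φ x + (1 + α) * (F x * Real.tan x)) ^ 2 * (1 + α)⁻¹ := by positivity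
    linarith

/-- **Weighted Wirtinger inequality** for primitives of functions in `L²(dν)`. -/
theorem weighted_wirtinger {α : ℝ} (hα : α ∈ Ioo (-1 : ℝ) 0) {ψ : ℝ → ℝ}
    (hψ : MemLp ψ 2 (cosMeasure α)) {C : ℝ}
    (h0 : ∫ x, (C + ∫ t in (0 : ℝ)..x, ψ t) ∂(cosMeasure α) = 0) :
    (1 + α) * ∫ x, (C + ∫ t in (0 : ℝ)..x, ψ t) ^ 2 ∂(cosMeasure α) ≤
      ∫ x, ψ x ^ 2 ∂(cosMeasure α) := by
  have hpi := Real.pi_pos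
  have hle : -(π / 2) ≤ π / 2 := by linarith
  have h1 : 0 < 1 + α := by linarith [hα.1]
  have hmem : (0 : ℝ) ∈ uIcc (-(π / 2)) (π / 2) := by
    rw [uIcc_of_le hle]; exact ⟨by linarith, by linarith⟩
  have hψi := intervalIntegrable_of_memLp_cosMeasure hα hψ
  have hψ2 := (integrable_cosMeasure_iff _ _).1 hψ.integrable_sq
  have hca := intervalIntegrable_cos_rpow hα
  set φ : ℝ → ℝ := fun x => C + ∫ t in (0 : ℝ)..x, ψ t with hφdef
  have hφac : AbsolutelyContinuousOnInterval φ (-(π / 2)) (π / 2) :=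
    (LipschitzWith.const C).lipschitzOnWith.absolutelyContinuousOnInterval.add
      (hψi.absolutelyContinuousOnInterval_intervalIntegral hmem)
  have hφc := hφac.continuousOn
  have hcφ : IntervalIntegrable (fun x => Real.cos x ^ α * φ x) volume (-(π / 2)) (π / 2) :=
    hca.mul_continuousOn hφc
  have hcφ2 : IntervalIntegrable (fun x => Real.cos x ^ α * φ x ^ 2) volume
      (-(π / 2)) (π / 2) := hca.mul_continuousOn (hφc.pow 2)
  set F : ℝ → ℝ := fun x => ∫ t in (-(π / 2))..x, Real.cos t ^ α * φ t with hFdef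
  have hFac : AbsolutelyContinuousOnInterval F (-(π / 2)) (π / 2) :=
    hcφ.absolutelyContinuousOnInterval_intervalIntegral left_mem_uIcc
  have hFc := hFac.continuousOn
  have hl : F (-(π / 2)) = 0 := by simp [F]
  -- This is where the zero mean of `φ` enters.
  have hr : F (π / 2) = 0 := by rw [← h0, integral_cosMeasure]
  have hca' : ∀ x ∈ Ioo (-(π / 2)) (π / 2), ContinuousAt (fun t => Real.cos t ^ α) x := fun x hx =>
    (hasDerivAt_cos_rpow hx α).continuousAt
  have hφa : ∀ x ∈ Ioo (-(π / 2)) (π / 2), ContinuousAt φ x := fun x hx => by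
    rw [uIcc_of_le hle] at hφc
    exact hφc.continuousAt (Icc_mem_nhds hx.1 hx.2)
  have hFd : ∀ x ∈ Ioo (-(π / 2)) (π / 2), HasDerivAt F (Real.cos x ^ α * φ x) x := by
    intro x hx
    refine intervalIntegral.integral_hasDerivAt_right (hcφ.mono_set ?_) ?_
      ((hca' x hx).mul (hφa x hx))
    · rw [uIcc_of_le hle, uIcc_of_le hx.1.le]
      exact Icc_subset_Icc_right hx.2.le
    · exact ContinuousOn.stronglyMeasurableAtFilter isOpen_Ioo
        (fun y hy => ((hca' y hy).mul (hφa y hy)).continuousWithinAt) x hx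
  obtain ⟨M, hM⟩ := hφac.exists_bound
  rw [uIcc_of_le hle] at hM hFc
  have hardy := integral_sq_mul_cos_rpow_neg_le hα hFc hFd
    (fun x hx => hM x (Ioo_subset_Icc_self hx)) hcφ2 hl hr
  have ibp := hφac.integral_deriv_mul_eq_sub hFac
  rw [hl, hr, mul_zero, mul_zero, sub_zero] at ibp
  have ibp2 : ∫ x in (-(π / 2))..(π / 2), (ψ x * F x + Real.cos x ^ α * φ x ^ 2) = 0 := by
    rw [← ibp]
    refine intervalIntegral.integral_congr_ae ?_
    have hne : ∀ᵐ x : ℝ, x ≠ π / 2 := by simp [ae_iff, measure_singleton]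
    filter_upwards [hψi.ae_hasDerivAt_integral, hne] with x hx hxne hxI
    have hxI' : x ∈ Ioo (-(π / 2)) (π / 2) := by
      rw [uIoc_of_le hle] at hxI
      exact ⟨hxI.1, lt_of_le_of_ne hxI.2 hxne⟩
    have hd := (hx (uIoc_subset_uIcc hxI) 0 hmem).const_add C
    rw [hd.deriv, (hFd x hxI').deriv]
    ring
  have hFc' : ContinuousOn F (uIcc (-(π / 2)) (π / 2)) := hFac.continuousOn
  have hψF : IntervalIntegrable (fun x => ψ x * F x) volume (-(π / 2)) (π / 2) :=
    hψi.mul_continuousOn hFc'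
  rw [intervalIntegral.integral_add hψF hcφ2] at ibp2
  have hF2 : IntervalIntegrable (fun x => F x ^ 2 * Real.cos x ^ (-α)) volume
      (-(π / 2)) (π / 2) :=
    ((hFc'.pow 2).mul (Real.continuous_cos.rpow_const fun _ =>
      Or.inr (by linarith [hα.2])).continuousOn).intervalIntegrable
  -- The integrand is `cos^α (ψ + (1+α) F cos^(-α))²`, which vanishes identically for `φ = sin`.
  have hsq : 0 ≤ ∫ x in (-(π / 2))..(π / 2), (Real.cos x ^ α * ψ x ^ 2 +
      (2 * (1 + α)) * (ψ x * F x) + (1 + α) ^ 2 * (F x ^ 2 * Real.cos x ^ (-α))) := by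
    rw [intervalIntegral.integral_of_le hle, integral_Ioc_eq_integral_Ioo]
    refine setIntegral_nonneg measurableSet_Ioo fun x hx => ?_
    have hP := Real.rpow_pos_of_pos (cos_pos_of_mem_halfPi hx) α
    rw [Real.rpow_neg (cos_pos_of_mem_halfPi hx).le]
    have : Real.cos x ^ α * ψ x ^ 2 + (2 * (1 + α)) * (ψ x * F x) +
        (1 + α) ^ 2 * (F x ^ 2 * (Real.cos x ^ α)⁻¹) =
        Real.cos x ^ α * (ψ x + (1 + α) * F x * (Real.cos x ^ α)⁻¹) ^ 2 := by
      field_simp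
      ring
    rw [this]
    positivity
  rw [intervalIntegral.integral_add (hψ2.add (hψF.const_mul _)) (hF2.const_mul _),
    intervalIntegral.integral_add hψ2 (hψF.const_mul _), intervalIntegral.integral_const_mul,
    intervalIntegral.integral_const_mul] at hsq
  rw [integral_cosMeasure, integral_cosMeasure]
  -- With `A = ∫ ψ² dν`, `B = ∫ φ² dν` and `H = ∫ F² cos^(-α)`, the square gives `0 ≤ A - 2(1+α)B +
  -- (1+α)²H`, and Hardy gives `(1+α)H ≤ B`.
  nlinarith [mul_le_mul_of_nonneg_left hardy h1.le]

/-! ### Weak derivatives and primitives. -/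

/-- A test function of vanishing integral is the derivative of a test function. -/
theorem exists_testFunction_deriv_eq {a b : ℝ} {θ : ℝ → ℝ} (hθ : ContDiff ℝ ∞ θ)
    (hc : HasCompactSupport θ) (hs : tsupport θ ⊆ Ioo a b) (h0 : ∫ x in a..b, θ x = 0) :
    ∃ η : ℝ → ℝ, ContDiff ℝ ∞ η ∧ HasCompactSupport η ∧ tsupport η ⊆ Ioo a b ∧ deriv η = θ := by
  rcases (tsupport θ).eq_empty_or_nonempty with he | hne
  · rw [tsupport_eq_empty_iff] at he
    refine ⟨0, contDiff_const, HasCompactSupport.zero, by simp, ?_⟩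
    ext x
    simp [he]
  obtain ⟨a', ha', hla⟩ := hc.isCompact.exists_isLeast hne
  obtain ⟨b', hb', hgb⟩ := hc.isCompact.exists_isGreatest hne
  have hcont : Continuous θ := hθ.continuous
  have hz : ∀ x, x ∉ Icc a' b' → θ x = 0 := fun x hx =>
    image_eq_zero_of_notMem_tsupport fun hx' => hx ⟨hla hx', hgb hx'⟩
  have hd : deriv (fun x => ∫ t in a..x, θ t) = θ := by
    ext x
    exact Continuous.deriv_integral θ hcont a x
  -- To the left of the support of `θ` the primitive is trivially zero; to the right it equals the
  -- full integral of `θ`, which is zero by assumption.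
  have hsupp : Function.support (fun x => ∫ t in a..x, θ t) ⊆ Icc a' b' := by
    intro x hx
    by_contra hxI
    apply hx
    rw [mem_Icc, not_and_or, not_le, not_le] at hxI
    rcases hxI with h | h
    · refine intervalIntegral.integral_zero_ae (ae_of_all _ fun t ht => hz t fun htI => ?_)
      have : t ≤ max a x := ht.2
      have := max_lt (hs ha').1 h
      linarith [htI.1]
    · have h1 : ∫ t in b..x, θ t = 0 := by
        refine intervalIntegral.integral_zero_ae (ae_of_all _ fun t ht => hz t fun htI => ?_)
        have h2 : min b x < t := ht.1
        have := lt_min (hs hb').2 h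
        linarith [htI.2]
      change ∫ t in a..x, θ t = 0
      rw [← intervalIntegral.integral_add_adjacent_intervals (hcont.intervalIntegrable a b)
        (hcont.intervalIntegrable b x), h0, h1, add_zero]
  have htsupp := closure_minimal hsupp isClosed_Icc
  refine ⟨fun x => ∫ t in a..x, θ t, ?_,
    HasCompactSupport.of_support_subset_isCompact isCompact_Icc hsupp, ?_, hd⟩
  · rw [contDiff_infty_iff_deriv, hd]
    exact ⟨fun x => (intervalIntegral.integral_hasDerivAt_right (hcont.intervalIntegrable _ _)
      (hcont.stronglyMeasurableAtFilter _ _) hcont.continuousAt).differentiableAt, hθ⟩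
  · exact htsupp.trans (Icc_subset_Ioo (hs ha').1 (hs hb').2)

theorem exists_testFunction_integral_eq_one {a b : ℝ} (hab : a < b) :
    ∃ ρ : ℝ → ℝ, ContDiff ℝ ∞ ρ ∧ HasCompactSupport ρ ∧ tsupport ρ ⊆ Ioo a b ∧
      ∫ x, ρ x = 1 := by
  let B : ContDiffBump ((a + b) / 2) :=
    ⟨(b - a) / 8, (b - a) / 4, by linarith, by linarith⟩
  refine ⟨B.normed volume, B.contDiff_normed, B.hasCompactSupport_normed, ?_,
    B.integral_normed⟩
  rw [B.tsupport_normed_eq, Real.closedBall_eq_Icc]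
  refine Icc_subset_Ioo ?_ ?_ <;> simp only [B] <;> linarith

theorem setIntegral_Ioo_eq_integral_of_tsupport_subset {a b : ℝ} {η : ℝ → ℝ}
    (hs : tsupport η ⊆ Ioo a b) (f : ℝ → ℝ) :
    ∫ x in Ioo a b, f x * η x = ∫ x, f x * η x :=
  setIntegral_eq_integral_of_forall_compl_eq_zero fun x hx => by
    rw [image_eq_zero_of_notMem_tsupport fun h => hx (hs h), mul_zero]

theorem integrable_mul_testFunction {a b : ℝ} {f η : ℝ → ℝ}
    (hf : LocallyIntegrableOn f (Ioo a b)) (hη : Continuous η) (hc : HasCompactSupport η)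
    (hs : tsupport η ⊆ Ioo a b) : Integrable fun x => f x * η x := by
  have h1 : IntegrableOn (fun x => f x * η x) (tsupport η) :=
    (hf.integrableOn_compact_subset hs hc.isCompact).mul_continuousOn hη.continuousOn hc.isCompact
  refine (integrableOn_iff_integrable_of_support_subset fun x hx => ?_).1 h1
  by_contra hx'
  exact hx (by simp [image_eq_zero_of_notMem_tsupport hx'])

/-- **Du Bois-Reymond lemma** on an interval. -/
theorem ae_eq_const_of_integral_mul_deriv_eq_zero {a b : ℝ} (hab : a < b) {w : ℝ → ℝ}
    (hw : LocallyIntegrableOn w (Ioo a b))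
    (h : ∀ η : ℝ → ℝ, ContDiff ℝ ∞ η → HasCompactSupport η → tsupport η ⊆ Ioo a b →
      ∫ t in Ioo a b, w t * deriv η t = 0) :
    ∃ C : ℝ, ∀ᵐ x, x ∈ Ioo a b → w x = C := by
  obtain ⟨ρ, hρ, hρc, hρs, hρ1⟩ := exists_testFunction_integral_eq_one hab
  refine ⟨∫ x, w x * ρ x, ?_⟩
  have hwρ := integrable_mul_testFunction hw hρ.continuous hρc hρs
  have hconst (c : ℝ) : LocallyIntegrableOn (fun _ : ℝ => c) (Ioo a b) :=
    (locallyIntegrable_const c).locallyIntegrableOn _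
  have key := isOpen_Ioo.ae_eq_zero_of_integral_contDiff_smul_eq_zero
    (hw.sub (hconst (∫ x, w x * ρ x))) (fun ζ hζ hζc hζs => ?_)
  · filter_upwards [key] with x hx hxI
    exact sub_eq_zero.1 (hx hxI)
  have hζi := hζ.continuous.integrable_of_hasCompactSupport hζc (μ := volume)
  have hρi := hρ.continuous.integrable_of_hasCompactSupport hρc (μ := volume)
  have hwζ := integrable_mul_testFunction hw hζ.continuous hζc hζs
  -- Subtracting `c ρ` makes the integral of `ζ` vanish, so `ζ - c ρ` is the derivative of a test
  -- function and may be fed to the hypothesis on `w`.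
  set c := ∫ x, ζ x
  have hθs : tsupport (fun x => ζ x - c * ρ x) ⊆ Ioo a b := by
    refine (tsupport_sub ζ fun x => c * ρ x).trans (union_subset hζs ?_)
    exact (tsupport_mul_subset_right (f := fun _ => c) (g := ρ)).trans hρs
  have hθ : ContDiff ℝ ∞ fun x => ζ x - c * ρ x := hζ.sub (contDiff_const.mul hρ)
  obtain ⟨η, hη, hηc, hηs, hηd⟩ := exists_testFunction_deriv_eq (a := a) (b := b)
    hθ (hζc.sub hρc.mul_left) hθs (by
      have := setIntegral_Ioo_eq_integral_of_tsupport_subset hθs fun _ => 1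
      simp only [one_mul] at this
      rw [intervalIntegral.integral_of_le hab.le, integral_Ioc_eq_integral_Ioo, this,
        integral_sub hζi (hρi.const_mul c), integral_const_mul, hρ1]
      simp [c])
  have h2 := h η hη hηc hηs
  rw [hηd, setIntegral_Ioo_eq_integral_of_tsupport_subset hθs] at h2
  have h3 : ∫ x, w x * (ζ x - c * ρ x) = ∫ x, (w x * ζ x - c * (w x * ρ x)) := by
    congr 1; ext x; ring
  rw [h3, integral_sub hwζ (hwρ.const_mul c), integral_const_mul] at h2
  have h4 : ∫ x, ζ x • (w - fun _ : ℝ => ∫ x, w x * ρ x : ℝ → ℝ) x =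
      ∫ x, (w x * ζ x - (∫ x, w x * ρ x) * ζ x) := by
    congr 1; ext x; simp; ring
  rw [h4, integral_sub hwζ (hζi.const_mul _), integral_const_mul]
  linarith

/-- A function with an integrable weak derivative is a.e. a primitive of it. -/
theorem IsWeakDerivOn.ae_eq_primitive {a b c : ℝ} (hab : a < b) {φ ψ : ℝ → ℝ}
    (h : IsWeakDerivOn φ ψ a b) (hψ : IntervalIntegrable ψ volume a b) (hc : c ∈ uIcc a b) :
    ∃ C : ℝ, ∀ᵐ x, x ∈ Ioo a b → φ x = C + ∫ t in c..x, ψ t := by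
  have hac := hψ.absolutelyContinuousOnInterval_intervalIntegral hc
  have hΨ : LocallyIntegrableOn (fun x => ∫ t in c..x, ψ t) (Ioo a b) := by
    refine ContinuousOn.locallyIntegrableOn (hac.continuousOn.mono ?_) measurableSet_Ioo
    rw [uIcc_of_le hab.le]
    exact Ioo_subset_Icc_self
  have key := ae_eq_const_of_integral_mul_deriv_eq_zero hab (h.1.sub hΨ)
    (fun η hη hηc hηs => ?_)
  · obtain ⟨C, hC⟩ := key
    refine ⟨C, ?_⟩
    filter_upwards [hC] with x hx hxI
    have := hx hxI
    simp only [Pi.sub_apply] at this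
    linarith
  have hη' : Continuous (deriv η) := hη.continuous_deriv (by simp)
  have hηs' : tsupport (deriv η) ⊆ Ioo a b := tsupport_deriv_subset.trans hηs
  have hηac : AbsolutelyContinuousOnInterval η a b :=
    ContDiffOn.absolutelyContinuousOnInterval ((hη.of_le (by simp)).contDiffOn)
  have hη0 : η a = 0 ∧ η b = 0 :=
    ⟨image_eq_zero_of_notMem_tsupport fun h => lt_irrefl _ (hηs h).1,
      image_eq_zero_of_notMem_tsupport fun h => lt_irrefl _ (hηs h).2⟩
  have ibp := hac.integral_mul_deriv_eq_deriv_mul hηac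
  rw [hη0.1, hη0.2, mul_zero, mul_zero, sub_zero, zero_sub] at ibp
  have hder : ∫ x in a..b, deriv (fun x => ∫ t in c..x, ψ t) x * η x = ∫ x in a..b, ψ x * η x := by
    refine intervalIntegral.integral_congr_ae ?_
    filter_upwards [hψ.ae_hasDerivAt_integral] with x hx hxI
    rw [(hx (uIoc_subset_uIcc hxI) c hc).deriv]
  rw [hder, intervalIntegral.integral_of_le hab.le, integral_Ioc_eq_integral_Ioo,
    intervalIntegral.integral_of_le hab.le, integral_Ioc_eq_integral_Ioo] at ibp
  have h1 := h.2.2 η hη hηc hηs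
  have i1 := integrable_mul_testFunction h.1 hη' hηc.deriv hηs'
  have i2 := integrable_mul_testFunction hΨ hη' hηc.deriv hηs'
  calc ∫ t in Ioo a b, (φ - fun x => ∫ t in c..x, ψ t) t * deriv η t
      = ∫ t in Ioo a b, (φ t * deriv η t - (∫ t in c..t, ψ t) * deriv η t) := by
        congr 1; ext x; simp; ring
    _ = 0 := by
        rw [integral_sub i1.integrableOn i2.integrableOn, h1, ibp, sub_self]

/-! ### The function `sin` as minimiser of the Rayleigh quotient. -/

theorem memLp_two_of_continuous_of_abs_le_one {α : ℝ} (hα : α ∈ Ioo (-1 : ℝ) 0) {f : ℝ → ℝ}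
    (hf : Continuous f) (hb : ∀ x, |f x| ≤ 1) : MemLp f 2 (cosMeasure α) := by
  have := isFiniteMeasure_cosMeasure hα
  exact MemLp.of_bound hf.aestronglyMeasurable 1 (ae_of_all _ hb)

theorem memWeightedH1_sin {α : ℝ} (hα : α ∈ Ioo (-1 : ℝ) 0) :
    MemWeightedH1 α Real.sin Real.cos := by
  have hpi := Real.pi_pos
  have hle : -(π / 2) ≤ π / 2 := by linarith
  refine ⟨memLp_two_of_continuous_of_abs_le_one hα Real.continuous_sin Real.abs_sin_le_one,
    memLp_two_of_continuous_of_abs_le_one hα Real.continuous_cos Real.abs_cos_le_one,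
    Real.continuous_sin.locallyIntegrable.locallyIntegrableOn _,
    Real.continuous_cos.locallyIntegrable.locallyIntegrableOn _, fun η hη _ hηs => ?_⟩
  have h1 : η (-(π / 2)) = 0 := image_eq_zero_of_notMem_tsupport fun h => lt_irrefl _ (hηs h).1
  have h2 : η (π / 2) = 0 := image_eq_zero_of_notMem_tsupport fun h => lt_irrefl _ (hηs h).2
  have := intervalIntegral.integral_mul_deriv_eq_deriv_mul (a := -(π / 2)) (b := π / 2)
    (fun x _ => Real.hasDerivAt_sin x)
    (fun x _ => (hη.differentiable (by simp) x).hasDerivAt)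
    (Real.continuous_cos.intervalIntegrable _ _)
    ((hη.continuous_deriv (by simp)).intervalIntegrable _ _)
  rwa [h1, h2, mul_zero, mul_zero, sub_zero, zero_sub, intervalIntegral.integral_of_le hle,
    integral_Ioc_eq_integral_Ioo, intervalIntegral.integral_of_le hle,
    integral_Ioc_eq_integral_Ioo] at this

theorem integral_sin_cosMeasure (α : ℝ) : ∫ t, Real.sin t ∂(cosMeasure α) = 0 := by
  rw [integral_cosMeasure]
  have := intervalIntegral.integral_comp_neg (a := -(π / 2)) (b := π / 2)
    (fun t => Real.cos t ^ α * Real.sin t)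
  simp only [Real.cos_neg, Real.sin_neg, mul_neg, intervalIntegral.integral_neg, neg_neg] at this
  linarith

/-- The difference of the two sides is the integral of the derivative of `cos^(1+α) sin`, which
vanishes at both endpoints because `1 + α > 0`. -/
theorem integral_cos_sq_cosMeasure {α : ℝ} (hα : α ∈ Ioo (-1 : ℝ) 0) :
    ∫ t, Real.cos t ^ 2 ∂(cosMeasure α) = (1 + α) * ∫ t, Real.sin t ^ 2 ∂(cosMeasure α) := by
  have h1 : 0 < 1 + α := by linarith [hα.1]
  have hle : -(π / 2) ≤ π / 2 := by linarith [Real.pi_pos]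
  have hca := intervalIntegrable_cos_rpow hα
  have hi1 : IntervalIntegrable (fun x => Real.cos x ^ α * Real.cos x ^ 2) volume
      (-(π / 2)) (π / 2) := hca.mul_continuousOn (Real.continuous_cos.pow 2).continuousOn
  have hi2 : IntervalIntegrable (fun x => Real.cos x ^ α * Real.sin x ^ 2) volume
      (-(π / 2)) (π / 2) := hca.mul_continuousOn (Real.continuous_sin.pow 2).continuousOn
  have key := intervalIntegral.integral_eq_sub_of_hasDerivAt_of_le hle
    (f := fun x => Real.cos x ^ (1 + α) * Real.sin x)
    ((Real.continuous_cos.rpow_const fun _ => Or.inr h1.le).mul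
          Real.continuous_sin).continuousOn
    (fun x hx => hasDerivAt_cos_rpow_mul_sin α hx)
    (hca.mul_continuousOn ((Real.continuous_cos.pow 2).sub
      (continuous_const.mul (Real.continuous_sin.pow 2))).continuousOn)
  simp only [Real.cos_neg, Real.cos_pi_div_two, Real.zero_rpow h1.ne', zero_mul, sub_zero] at key
  rw [integral_cosMeasure, integral_cosMeasure, ← intervalIntegral.integral_const_mul,
    ← sub_eq_zero, ← intervalIntegral.integral_sub hi1 (hi2.const_mul _), ← key]
  congr 1; ext x; ring

theorem cosMeasure_univ_pos {α : ℝ} (hα : α ∈ Ioo (-1 : ℝ) 0) :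
    0 < ∫ _, (1 : ℝ) ∂(cosMeasure α) := by
  rw [integral_cosMeasure]
  refine intervalIntegral.intervalIntegral_pos_of_pos_on
    (by simpa using intervalIntegrable_cos_rpow hα) (fun x hx => ?_) (by linarith [Real.pi_pos])
  rw [mul_one]
  exact Real.rpow_pos_of_pos (cos_pos_of_mem_halfPi hx) α

/-- Adding the integrals of `sin²` and `cos²` shows that the total mass of `ν` is `(2+α) ∫ sin² dν`.
-/
theorem integral_sin_sq_cosMeasure_pos {α : ℝ} (hα : α ∈ Ioo (-1 : ℝ) 0) :
    0 < ∫ t, Real.sin t ^ 2 ∂(cosMeasure α) := by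
  have h := cosMeasure_univ_pos hα
  have hs : ∫ _, (1 : ℝ) ∂(cosMeasure α) =
      ∫ t, Real.sin t ^ 2 ∂(cosMeasure α) + ∫ t, Real.cos t ^ 2 ∂(cosMeasure α) := by
    rw [← integral_add (memWeightedH1_sin hα).1.integrable_sq
      (memWeightedH1_sin hα).2.1.integrable_sq]
    simp
  rw [hs, integral_cos_sq_cosMeasure hα] at h
  have h1 : 0 < 1 + (1 + α) := by linarith [hα.1]
  exact pos_of_mul_pos_right (a := 1 + (1 + α)) (by linarith) h1.le

theorem isLeast_rayleighValues {α : ℝ} (hα : α ∈ Ioo (-1 : ℝ) 0) :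
    IsLeast (rayleighValues α) (1 + α) := by
  have hpi := Real.pi_pos
  have hlt : -(π / 2) < π / 2 := by linarith
  refine ⟨⟨Real.sin, Real.cos, memWeightedH1_sin hα, integral_sin_cosMeasure α, fun h => ?_, ?_⟩,
    ?_⟩
  · have h0 : ∫ t, Real.sin t ^ 2 ∂(cosMeasure α) = 0 :=
      integral_eq_zero_of_ae (h.mono fun t ht => by simp at ht; simp [ht])
    exact (integral_sin_sq_cosMeasure_pos hα).ne' h0
  · rw [integral_cos_sq_cosMeasure hα, mul_div_cancel_right₀ _
      (integral_sin_sq_cosMeasure_pos hα).ne']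
  · rintro q ⟨φ, ψ, ⟨hφ, hψ, hw⟩, h0, hne, rfl⟩
    have hpos : 0 < ∫ t, φ t ^ 2 ∂(cosMeasure α) := by
      refine lt_of_le_of_ne (integral_nonneg fun t => sq_nonneg _) fun h => hne ?_
      have := (integral_eq_zero_iff_of_nonneg (fun t => sq_nonneg _) hφ.integrable_sq).1 h.symm
      filter_upwards [this] with t ht
      simpa using ht
    -- The quotient depends only on almost everywhere classes, so `φ` may be replaced by a primitive
    -- of `ψ`.
    obtain ⟨C, hC⟩ := hw.ae_eq_primitive hlt (intervalIntegrable_of_memLp_cosMeasure hα hψ)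
      (c := 0) (by rw [uIcc_of_le hlt.le]; exact ⟨by linarith, by linarith⟩)
    rw [← ae_cosMeasure_iff α] at hC
    have e1 : ∫ t, φ t ∂(cosMeasure α) = ∫ x, (C + ∫ t in (0 : ℝ)..x, ψ t) ∂(cosMeasure α) :=
      integral_congr_ae hC
    have e2 : ∫ t, φ t ^ 2 ∂(cosMeasure α) =
        ∫ x, (C + ∫ t in (0 : ℝ)..x, ψ t) ^ 2 ∂(cosMeasure α) :=
      integral_congr_ae (hC.mono fun t ht => by simp only [ht])
    rw [le_div_iff₀ hpos, e2]
    exact weighted_wirtinger hα hψ (e1 ▸ h0)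

/-! ### The area formula for curves. -/

/-- The Lindelöf property gives a countable subcover; making it disjoint only shrinks its members,
which a hereditary property `P` survives. -/
theorem exists_disjoint_measurable_cover {s : Set ℝ} {P : Set ℝ → Prop} (hP0 : P ∅)
    (hP : ∀ U V, P U → V ⊆ U → P V) (h : ∀ x ∈ s, ∃ U, IsOpen U ∧ x ∈ U ∧ P U) :
    ∃ D : ℕ → Set ℝ, Pairwise (Function.onFun Disjoint D) ∧ (∀ n, MeasurableSet (D n)) ∧
      s ⊆ ⋃ n, D n ∧ ∀ n, P (D n) := by
  choose! U hUo hxU hPU using h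
  obtain ⟨t, hts, htc, hst⟩ := TopologicalSpace.countable_cover_nhdsWithin
    (s := s) (f := U) fun x hx => mem_nhdsWithin_of_mem_nhds ((hUo x hx).mem_nhds (hxU x hx))
  rcases t.eq_empty_or_nonempty with rfl | hne
  · refine ⟨fun _ => ∅, by simp [Pairwise, Function.onFun], by simp, by simpa using hst,
      fun _ => hP0⟩
  obtain ⟨f, rfl⟩ := htc.exists_eq_range hne
  refine ⟨disjointed fun n => U (f n), disjoint_disjointed _, fun n => ?_, ?_, fun n => ?_⟩
  · exact MeasurableSet.disjointed (fun n => (hUo _ (hts (mem_range_self n))).measurableSet) n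
  · rwa [iUnion_disjointed, ← biUnion_range]
  · exact hP _ _ (hPU _ (hts (mem_range_self n))) (disjointed_subset _ n)

/-- Let `η → 0`. Infinite values cause no trouble because the limiting factor `1` is nonzero. -/
theorem le_of_forall_one_sub_mul_le {a b : ℝ≥0∞}
    (h : ∀ η ∈ Ioo (0 : ℝ) 1, ENNReal.ofReal (1 - η) * a ≤ ENNReal.ofReal (1 + η) * b) :
    a ≤ b := by
  have ht : Tendsto (fun η : ℝ => η) (𝓝[>] 0) (𝓝 0) := nhdsWithin_le_nhds
  have h1 : Tendsto (fun η : ℝ => ENNReal.ofReal (1 - η) * a) (𝓝[>] 0) (𝓝 (1 * a)) := by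
    refine ENNReal.Tendsto.mul_const ?_ (Or.inl one_ne_zero)
    simpa using ENNReal.tendsto_ofReal (ht.const_sub 1)
  have h2 : Tendsto (fun η : ℝ => ENNReal.ofReal (1 + η) * b) (𝓝[>] 0) (𝓝 (1 * b)) := by
    refine ENNReal.Tendsto.mul_const ?_ (Or.inl one_ne_zero)
    simpa using ENNReal.tendsto_ofReal (ht.const_add 1)
  rw [one_mul] at h1 h2
  refine le_of_tendsto_of_tendsto h1 h2 ?_
  filter_upwards [Ioo_mem_nhdsGT (zero_lt_one' ℝ)] with η hη using h η hη

/-- Both the Hausdorff measure of the image and the integral of the speed lie between `c(1-η)` and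
`c(1+η)` times the length of `A`. For the Hausdorff measure, the upper bound uses the Lipschitz
constant of `γ` and the lower bound that of its inverse. -/
theorem hausdorffMeasure_image_bounds {E : Type*} [NormedAddCommGroup E] [MeasurableSpace E]
    [BorelSpace E] {γ γ' : ℝ → E} {s : Set ℝ} (hinj : InjOn γ s) {A : Set ℝ} (hA : MeasurableSet A)
    (hAs : A ⊆ s) {c η : ℝ} (hc0 : 0 < c) (hη : η ∈ Ioo (0 : ℝ) 1)
    (hn : ∀ x ∈ A, c * (1 - η) ≤ ‖γ' x‖ ∧ ‖γ' x‖ ≤ c * (1 + η))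
    (hl : ∀ x ∈ A, ∀ y ∈ A, c * (1 - η) * dist x y ≤ dist (γ x) (γ y) ∧
        dist (γ x) (γ y) ≤ c * (1 + η) * dist x y) :
    ENNReal.ofReal (1 - η) * μH[1] (γ '' A) ≤
        ENNReal.ofReal (1 + η) * ∫⁻ x in A, ‖γ' x‖ₑ ∧
      ENNReal.ofReal (1 - η) * ∫⁻ x in A, ‖γ' x‖ₑ ≤
        ENNReal.ofReal (1 + η) * μH[1] (γ '' A) := by
  have hm : 0 < 1 - η := by linarith [hη.2]
  have hp : 0 < 1 + η := by linarith [hη.1]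
  have hcm : 0 < c * (1 - η) := mul_pos hc0 hm
  have hcp : 0 < c * (1 + η) := mul_pos hc0 hp
  have hI1 : ENNReal.ofReal (c * (1 - η)) * volume A ≤ ∫⁻ x in A, ‖γ' x‖ₑ := by
    rw [← setLIntegral_const]
    refine setLIntegral_mono' hA fun x hx => ?_
    rw [← ofReal_norm]
    exact ENNReal.ofReal_le_ofReal (hn x hx).1
  have hI2 : ∫⁻ x in A, ‖γ' x‖ₑ ≤ ENNReal.ofReal (c * (1 + η)) * volume A := by
    rw [← setLIntegral_const]
    refine setLIntegral_mono' hA fun x hx => ?_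
    rw [← ofReal_norm]
    exact ENNReal.ofReal_le_ofReal (hn x hx).2
  have hH2 : μH[1] (γ '' A) ≤ ENNReal.ofReal (c * (1 + η)) * volume A := by
    have hL : LipschitzOnWith (c * (1 + η)).toNNReal γ A :=
      LipschitzOnWith.of_dist_le_mul fun x hx y hy => by
        rw [Real.coe_toNNReal _ hcp.le]; exact (hl x hx y hy).2
    have := hL.hausdorffMeasure_image_le zero_le_one
    rwa [ENNReal.rpow_one, hausdorffMeasure_real] at this
  have hH1 : ENNReal.ofReal (c * (1 - η)) * volume A ≤ μH[1] (γ '' A) := by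
    have hinjA := hinj.mono hAs
    have hleft := hinjA.leftInvOn_invFunOn
    have hL : LipschitzOnWith ((c * (1 - η))⁻¹).toNNReal (Function.invFunOn γ A) (γ '' A) := by
      refine LipschitzOnWith.of_dist_le_mul ?_
      rintro _ ⟨x, hx, rfl⟩ _ ⟨y, hy, rfl⟩
      rw [hleft hx, hleft hy, Real.coe_toNNReal _ (inv_nonneg.2 hcm.le), ← div_eq_inv_mul,
        le_div_iff₀' hcm]
      exact (hl x hx y hy).1
    have := hL.hausdorffMeasure_image_le zero_le_one
    rw [ENNReal.rpow_one, hausdorffMeasure_real, hleft.image_image] at this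
    calc ENNReal.ofReal (c * (1 - η)) * volume A
        ≤ ENNReal.ofReal (c * (1 - η)) * (ENNReal.ofReal ((c * (1 - η))⁻¹) * μH[1] (γ '' A)) := by
          gcongr; exact this
      _ = μH[1] (γ '' A) := by
          rw [← mul_assoc, ← ENNReal.ofReal_mul hcm.le, mul_inv_cancel₀ hcm.ne',
            ENNReal.ofReal_one, one_mul]
  have hswap : ENNReal.ofReal (1 - η) * (ENNReal.ofReal (c * (1 + η)) * volume A) =
      ENNReal.ofReal (1 + η) * (ENNReal.ofReal (c * (1 - η)) * volume A) := by
    rw [← mul_assoc, ← mul_assoc, ← ENNReal.ofReal_mul hm.le, ← ENNReal.ofReal_mul hp.le]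
    congr 2; ring
  constructor
  · calc _ ≤ ENNReal.ofReal (1 - η) * (ENNReal.ofReal (c * (1 + η)) * volume A) := by gcongr
      _ = _ := hswap
      _ ≤ _ := by gcongr
  · calc _ ≤ ENNReal.ofReal (1 - η) * (ENNReal.ofReal (c * (1 + η)) * volume A) := by gcongr
      _ = _ := hswap
      _ ≤ _ := by gcongr

/-- Near a point with nonzero derivative, a `C¹` curve is almost an isometry up to scaling. -/
theorem exists_open_lipschitz_of_hasDerivAt {E : Type*} [NormedAddCommGroup E]
    [NormedSpace ℝ E] {γ γ' : ℝ → E} {s : Set ℝ} (hs : IsOpen s) (hd : ∀ x ∈ s, HasDerivAt γ (γ' x) x)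
    (hc : ContinuousOn γ' s) (hne : ∀ x ∈ s, γ' x ≠ 0) {η : ℝ} (hη : η ∈ Ioo (0 : ℝ) 1)
    {x₀ : ℝ} (hx₀ : x₀ ∈ s) : ∃ U, IsOpen U ∧ x₀ ∈ U ∧ ∃ c : ℝ, 0 < c ∧
      (∀ x ∈ U, c * (1 - η) ≤ ‖γ' x‖ ∧ ‖γ' x‖ ≤ c * (1 + η)) ∧
      ∀ x ∈ U, ∀ y ∈ U, c * (1 - η) * dist x y ≤ dist (γ x) (γ y) ∧
        dist (γ x) (γ y) ≤ c * (1 + η) * dist x y := by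
  have hcpos : 0 < ‖γ' x₀‖ := norm_pos_iff.2 (hne x₀ hx₀)
  have hε : 0 < ‖γ' x₀‖ * η := mul_pos hcpos hη.1
  have hca := hc.continuousAt (hs.mem_nhds hx₀)
  have hstrict : HasStrictDerivAt γ (γ' x₀) x₀ :=
    hasStrictDerivAt_of_hasDerivAt_of_continuousAt
      (Filter.eventually_of_mem (hs.mem_nhds hx₀) hd) hca
  have h1 := hstrict.isLittleO.def hε
  rw [nhds_prod_eq] at h1
  obtain ⟨U, hU, hUU⟩ := Filter.mem_prod_self_iff.1 h1
  have h2 : ∀ᶠ x in 𝓝 x₀, ‖γ' x - γ' x₀‖ < ‖γ' x₀‖ * η := by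
    have := Metric.tendsto_nhds.1 hca _ hε
    simpa only [dist_eq_norm] using this
  obtain ⟨V, hVsub, hVo, hxV⟩ := mem_nhds_iff.1 (inter_mem hU h2)
  refine ⟨V, hVo, hxV, ‖γ' x₀‖, hcpos, fun x hx => ?_, fun x hx y hy => ?_⟩
  · have h3 := (hVsub hx).2
    have h4 := norm_sub_norm_le (γ' x) (γ' x₀)
    have h5 := norm_sub_norm_le (γ' x₀) (γ' x)
    rw [norm_sub_rev] at h5
    simp only [mem_ofPred_eq] at h3
    constructor <;> nlinarith
  · have h3 := hUU (mk_mem_prod (hVsub hx).1 (hVsub hy).1)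
    simp only [mem_ofPred_eq, ContinuousLinearMap.toSpanSingleton_apply] at h3
    rw [dist_eq_norm, dist_eq_norm]
    have h4 := norm_sub_norm_le (γ x - γ y) ((x - y) • γ' x₀)
    have h5 := norm_sub_norm_le ((x - y) • γ' x₀) (γ x - γ y)
    rw [norm_sub_rev ((x - y) • γ' x₀)] at h5
    rw [norm_smul] at h4 h5
    constructor <;> nlinarith

section AreaFormula

variable {E : Type*} [NormedAddCommGroup E] [NormedSpace ℝ E] [MeasurableSpace E] [BorelSpace E]
  {γ γ' : ℝ → E} {s : Set ℝ}

/-- The one-dimensional Hausdorff measure of an injective regular `C¹` curve is its length. -/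
theorem hausdorffMeasure_image_eq_lintegral (hs : IsOpen s)
    (hd : ∀ x ∈ s, HasDerivAt γ (γ' x) x) (hc : ContinuousOn γ' s) (hne : ∀ x ∈ s, γ' x ≠ 0)
    (hinj : InjOn γ s) {A : Set ℝ} (hA : MeasurableSet A) (hAs : A ⊆ s) :
    μH[1] (γ '' A) = ∫⁻ x in A, ‖γ' x‖ₑ := by
  have hcont : ContinuousOn γ s := fun x hx => (hd x hx).continuousAt.continuousWithinAt
  have key : ∀ η ∈ Ioo (0 : ℝ) 1, ENNReal.ofReal (1 - η) * μH[1] (γ '' A) ≤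
        ENNReal.ofReal (1 + η) * ∫⁻ x in A, ‖γ' x‖ₑ ∧
      ENNReal.ofReal (1 - η) * ∫⁻ x in A, ‖γ' x‖ₑ ≤
        ENNReal.ofReal (1 + η) * μH[1] (γ '' A) := by
    intro η hη
    obtain ⟨D, hDd, hDm, hDs, hDP⟩ := exists_disjoint_measurable_cover (s := s)
      (P := fun U => ∃ c : ℝ, 0 < c ∧
        (∀ x ∈ U, c * (1 - η) ≤ ‖γ' x‖ ∧ ‖γ' x‖ ≤ c * (1 + η)) ∧
        ∀ x ∈ U, ∀ y ∈ U, c * (1 - η) * dist x y ≤ dist (γ x) (γ y) ∧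
          dist (γ x) (γ y) ≤ c * (1 + η) * dist x y)
      ⟨1, one_pos, by simp, by simp⟩
      (fun U V ⟨c, h0, h1, h2⟩ hVU =>
        ⟨c, h0, fun x hx => h1 x (hVU hx), fun x hx y hy => h2 x (hVU hx) y (hVU hy)⟩)
      (fun x hx => exists_open_lipschitz_of_hasDerivAt hs hd hc hne hη hx)
    have hAD : A = ⋃ n, A ∩ D n := by
      rw [← inter_iUnion, inter_eq_left.2 (hAs.trans hDs)]
    have hdisj : Pairwise (Function.onFun Disjoint fun n => A ∩ D n) := fun i j hij =>
      (hDd hij).mono inter_subset_right inter_subset_right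
    have hmeas : ∀ n, MeasurableSet (A ∩ D n) := fun n => hA.inter (hDm n)
    have hsub : ∀ n, A ∩ D n ⊆ s := fun n => inter_subset_left.trans hAs
    -- Injectivity keeps the images of the pieces disjoint, and they are Borel by the Lusin–Souslin
    -- theorem.
    have hH : μH[1] (γ '' A) = ∑' n, μH[1] (γ '' (A ∩ D n)) := by
      conv_lhs => rw [hAD, image_iUnion]
      refine measure_iUnion (fun i j hij => ?_) fun n => ?_
      · exact (hdisj hij).image hinj (hsub i) (hsub j)
      · exact (hmeas n).image_of_continuousOn_injOn (hcont.mono (hsub n)) (hinj.mono (hsub n))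
    have hI : ∫⁻ x in A, ‖γ' x‖ₑ = ∑' n, ∫⁻ x in A ∩ D n, ‖γ' x‖ₑ := by
      conv_lhs => rw [hAD]
      exact lintegral_iUnion hmeas hdisj _
    rw [hH, hI]
    simp only [← ENNReal.tsum_mul_left]
    choose c h0 h1 h2 using hDP
    have hb := fun n => hausdorffMeasure_image_bounds (γ' := γ') hinj (hmeas n) (hsub n) (h0 n) hη
      (fun x hx => h1 n x hx.2) (fun x hx y hy => h2 n x hx.2 y hy.2)
    exact ⟨ENNReal.tsum_le_tsum fun n => (hb n).1, ENNReal.tsum_le_tsum fun n => (hb n).2⟩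
  exact le_antisymm (le_of_forall_one_sub_mul_le fun η hη => (key η hη).1)
    (le_of_forall_one_sub_mul_le fun η hη => (key η hη).2)

/-- **Area formula** for curves. -/
theorem lintegral_image_hausdorffMeasure_one (hs : IsOpen s)
    (hd : ∀ x ∈ s, HasDerivAt γ (γ' x) x) (hc : ContinuousOn γ' s) (hne : ∀ x ∈ s, γ' x ≠ 0)
    (hinj : InjOn γ s) {g : E → ℝ≥0∞} (hg : Measurable g) :
    ∫⁻ y in γ '' s, g y ∂μH[1] = ∫⁻ x in s, ‖γ' x‖ₑ * g (γ x) := by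
  have hcont : ContinuousOn γ s := fun x hx => (hd x hx).continuousAt.continuousWithinAt
  have hγm : AEMeasurable γ ((volume.restrict s).withDensity fun x => ‖γ' x‖ₑ) :=
    (hcont.aemeasurable hs.measurableSet).mono_ac (withDensity_absolutelyContinuous _ _)
  -- Applied to preimages, the length formula says that Hausdorff measure on the curve is the
  -- push-forward of the length element.
  have hmap : (μH[1] : Measure E).restrict (γ '' s) =
      ((volume.restrict s).withDensity fun x => ‖γ' x‖ₑ).map γ := by
    ext B hB
    have hpre : MeasurableSet (s ∩ γ ⁻¹' B) := by
      rw [← Subtype.image_preimage_coe]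
      exact hs.measurableSet.subtype_image (hcont.domRestrict.measurable hB)
    have hset : B ∩ γ '' s = γ '' (s ∩ γ ⁻¹' B) := by
      rw [image_inter_preimage, inter_comm]
    rw [Measure.restrict_apply hB, hset,
      hausdorffMeasure_image_eq_lintegral hs hd hc hne hinj hpre inter_subset_left,
      Measure.map_apply_of_aemeasurable hγm hB, withDensity_apply',
      Measure.restrict_restrict' hs.measurableSet, inter_comm]
  rw [hmap, lintegral_map' hg.aemeasurable hγm]
  exact lintegral_withDensity_eq_lintegral_mul₀ (hc.aemeasurable hs.measurableSet).enorm
    (hg.comp_aemeasurable (hcont.aemeasurable hs.measurableSet))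

end AreaFormula

/-! ### Polar graphs: their boundary, weighted length and weighted volume. -/

/-- The angle in `(-π/2, π/2)` of a point of the upper half-plane, measured from the `x_N`-axis. -/
noncomputable def polarAngle (x : Plane) : ℝ := Real.arctan (x 0 / x 1)

/-- The region of the upper half-plane below the polar graph `r = ρ(θ)`. -/
def polarSubgraph (ρ : ℝ → ℝ) : Set Plane :=
  {x | x ∈ upperHalf ∧ ∃ r θ : ℝ, θ ∈ Ioo (-(π / 2)) (π / 2) ∧
    0 ≤ r ∧ r < ρ θ ∧ x = polarPoint r θ}

theorem perturbedHalfDisc_eq_polarSubgraph (u s : ℝ → ℝ) (t : ℝ) :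
    perturbedHalfDisc u s t = polarSubgraph fun θ => 1 + t * u θ + s t := rfl

@[simp] theorem polarPoint_zero (r θ : ℝ) : polarPoint r θ 0 = r * Real.sin θ := rfl

@[simp] theorem polarPoint_one (r θ : ℝ) : polarPoint r θ 1 = r * Real.cos θ := rfl

theorem norm_polarPoint {r : ℝ} (hr : 0 ≤ r) (θ : ℝ) : ‖polarPoint r θ‖ = r := by
  rw [EuclideanSpace.norm_eq, Fin.sum_univ_two]
  simp only [polarPoint_zero, polarPoint_one, Real.norm_eq_abs, sq_abs]
  rw [← Real.sqrt_sq hr]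
  congr 1
  rw [Real.sqrt_sq hr]
  linear_combination r ^ 2 * Real.sin_sq_add_cos_sq θ

theorem polarAngle_polarPoint {r θ : ℝ} (hr : 0 < r) (hθ : θ ∈ Ioo (-(π / 2)) (π / 2)) :
    polarAngle (polarPoint r θ) = θ := by
  rw [polarAngle, polarPoint_zero, polarPoint_one, mul_div_mul_left _ _ hr.ne',
    ← Real.tan_eq_sin_div_cos, Real.arctan_tan hθ.1 hθ.2]

theorem polarAngle_mem (x : Plane) : polarAngle x ∈ Ioo (-(π / 2)) (π / 2) :=
  Real.arctan_mem_Ioo _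

theorem polarPoint_mem_upperHalf {r θ : ℝ} (hr : 0 < r) (hθ : θ ∈ Ioo (-(π / 2)) (π / 2)) :
    polarPoint r θ ∈ upperHalf :=
  mul_pos hr (cos_pos_of_mem_halfPi hθ)

theorem norm_pos_of_mem_upperHalf {x : Plane} (hx : x ∈ upperHalf) : 0 < ‖x‖ := by
  refine norm_pos_iff.2 fun h => ?_
  rw [h] at hx
  exact lt_irrefl (0 : ℝ) hx

theorem polarPoint_norm_polarAngle {x : Plane} (hx : x ∈ upperHalf) :
    polarPoint ‖x‖ (polarAngle x) = x := by
  have h1 : 0 < x 1 := hx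
  have hn : ‖x‖ = x 1 * √(1 + (x 0 / x 1) ^ 2) := by
    rw [EuclideanSpace.norm_eq, Fin.sum_univ_two]
    simp only [Real.norm_eq_abs, sq_abs]
    nth_rewrite 2 [← Real.sqrt_sq h1.le]
    rw [← Real.sqrt_mul (sq_nonneg _)]
    congr 1
    field_simp
    ring
  have hs : 0 < √(1 + (x 0 / x 1) ^ 2) := by positivity
  ext i
  fin_cases i
  · change ‖x‖ * Real.sin (polarAngle x) = x 0
    rw [polarAngle, Real.sin_arctan, hn]
    field_simp
  · change ‖x‖ * Real.cos (polarAngle x) = x 1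
    rw [polarAngle, Real.cos_arctan, hn]
    field_simp

/-- On the upper half-plane the norm and `polarAngle` invert `polarPoint`, which removes the
existential quantifier. -/
theorem mem_polarSubgraph {ρ : ℝ → ℝ} {x : Plane} :
    x ∈ polarSubgraph ρ ↔ x ∈ upperHalf ∧ ‖x‖ < ρ (polarAngle x) := by
  constructor
  · rintro ⟨hx, r, θ, hθ, hr, hlt, rfl⟩
    have hr' : 0 < r := by
      have := norm_pos_of_mem_upperHalf hx
      rwa [norm_polarPoint hr] at this
    rw [norm_polarPoint hr, polarAngle_polarPoint hr' hθ]
    exact ⟨hx, hlt⟩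
  · rintro ⟨hx, hlt⟩
    exact ⟨hx, ‖x‖, polarAngle x, polarAngle_mem x, norm_nonneg _, hlt,
      (polarPoint_norm_polarAngle hx).symm⟩

theorem continuous_coord (i : Fin 2) : Continuous fun x : Plane => x i := by fun_prop

theorem isOpen_upperHalf : IsOpen upperHalf := isOpen_lt continuous_const (continuous_coord 1)

theorem continuousOn_comp_polarAngle {ρ : ℝ → ℝ} (hρ : ContinuousOn ρ (Ioo (-(π / 2)) (π / 2))) :
    ContinuousOn (fun x => ρ (polarAngle x)) upperHalf := by
  refine hρ.comp ?_ fun x _ => polarAngle_mem x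
  exact Real.continuous_arctan.comp_continuousOn
    ((continuous_coord 0).continuousOn.div (continuous_coord 1).continuousOn
      fun x hx => ne_of_gt hx)

theorem isOpen_polarSubgraph {ρ : ℝ → ℝ} (hρ : ContinuousOn ρ (Ioo (-(π / 2)) (π / 2))) :
    IsOpen (polarSubgraph ρ) := by
  have : polarSubgraph ρ = upperHalf ∩ (fun x => ρ (polarAngle x) - ‖x‖) ⁻¹' Ioi 0 := by
    ext x
    simp [mem_polarSubgraph]
  rw [this]
  exact ((continuousOn_comp_polarAngle hρ).sub continuous_norm.continuousOn).isOpen_inter_preimage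
    isOpen_upperHalf isOpen_Ioi

theorem frontier_polarSubgraph_inter {ρ : ℝ → ℝ}
    (hρ : ContinuousOn ρ (Ioo (-(π / 2)) (π / 2))) (hpos : ∀ θ ∈ Ioo (-(π / 2)) (π / 2), 0 < ρ θ) :
    frontier (polarSubgraph ρ) ∩ upperHalf =
      (fun θ => polarPoint (ρ θ) θ) '' Ioo (-(π / 2)) (π / 2) := by
  have hset : (fun θ => polarPoint (ρ θ) θ) '' Ioo (-(π / 2)) (π / 2) =
      {x | x ∈ upperHalf ∧ ‖x‖ = ρ (polarAngle x)} := by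
    ext x
    constructor
    · rintro ⟨θ, hθ, rfl⟩
      have hp := hpos θ hθ
      exact ⟨polarPoint_mem_upperHalf hp hθ, by
        simp only [norm_polarPoint hp.le, polarAngle_polarPoint hp hθ]⟩
    · rintro ⟨hx, h⟩
      refine ⟨polarAngle x, polarAngle_mem x, ?_⟩
      simp only [← h]
      exact polarPoint_norm_polarAngle hx
  rw [hset, (isOpen_polarSubgraph hρ).frontier_eq]
  ext x
  constructor
  · rintro ⟨⟨hcl, hnot⟩, hx⟩
    refine ⟨hx, le_antisymm ?_ (not_lt.1 fun h => hnot (mem_polarSubgraph.2 ⟨hx, h⟩))⟩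
    by_contra! hlt
    have hopen : IsOpen (upperHalf ∩ (fun x => ‖x‖ - ρ (polarAngle x)) ⁻¹' Ioi 0) :=
      (continuous_norm.continuousOn.sub (continuousOn_comp_polarAngle hρ)).isOpen_inter_preimage
        isOpen_upperHalf isOpen_Ioi
    obtain ⟨y, ⟨_, hy⟩, hyU⟩ := mem_closure_iff.1 hcl _ hopen ⟨hx, by simpa using hlt⟩
    have := (mem_polarSubgraph.1 hyU).2
    simp only [mem_preimage, mem_Ioi, sub_pos] at hy
    exact lt_asymm hy this
  · rintro ⟨hx, h⟩
    refine ⟨⟨?_, fun hU => (mem_polarSubgraph.1 hU).2.ne h⟩, hx⟩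
    -- Shrinking `x` towards the origin keeps its angle and moves it strictly below the graph, so
    -- `x` lies in the closure.
    have ht : Tendsto (fun c : ℝ => c • x) (𝓝[<] 1) (𝓝 x) := by
      have : Tendsto (fun c : ℝ => c • x) (𝓝 1) (𝓝 ((1 : ℝ) • x)) :=
        (continuous_id.smul continuous_const).continuousAt
      rw [one_smul] at this
      exact this.mono_left nhdsWithin_le_nhds
    refine mem_closure_of_tendsto ht ?_
    filter_upwards [Ioo_mem_nhdsLT (zero_lt_one' ℝ)] with c hc
    rw [mem_polarSubgraph]
    have hang : polarAngle (c • x) = polarAngle x := by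
      simp only [polarAngle, PiLp.smul_apply, smul_eq_mul]
      rw [mul_div_mul_left _ _ hc.1.ne']
    refine ⟨mul_pos hc.1 hx, ?_⟩
    rw [hang, ← h, norm_smul, Real.norm_of_nonneg hc.1.le]
    exact mul_lt_of_lt_one_left (norm_pos_of_mem_upperHalf hx) hc.2

theorem hasDerivAt_plane {f g : ℝ → ℝ} {f' g' x : ℝ} (hf : HasDerivAt f f' x)
    (hg : HasDerivAt g g' x) :
    HasDerivAt (fun y => (!₂[f y, g y] : Plane)) (!₂[f', g'] : Plane) x := by
  have h : HasDerivAt (fun y => ![f y, g y]) ![f', g'] x := by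
    rw [hasDerivAt_pi]
    intro i
    fin_cases i
    · exact hf
    · exact hg
  exact (PiLp.continuousLinearEquiv 2 ℝ
    (fun _ : Fin 2 => ℝ)).symm.toContinuousLinearMap.hasFDerivAt.comp_hasDerivAt x h

theorem continuousOn_plane {f g : ℝ → ℝ} {s : Set ℝ} (hf : ContinuousOn f s)
    (hg : ContinuousOn g s) : ContinuousOn (fun y => (!₂[f y, g y] : Plane)) s := by
  have h : ContinuousOn (fun y => ![f y, g y]) s := by
    rw [continuousOn_pi]
    intro i
    fin_cases i
    · exact hf
    · exact hg
  exact (PiLp.continuousLinearEquiv 2 ℝ (fun _ : Fin 2 => ℝ)).symm.continuous.comp_continuousOn h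

theorem measurable_planeWeight (k α : ℝ) : Measurable (planeWeight k α) :=
  ((measurable_norm.pow_const k).mul
    ((continuous_coord 1).measurable.pow_const α)).ennreal_ofReal

theorem planeWeight_polarPoint {α r θ : ℝ} (hr : 0 < r) (hθ : θ ∈ Ioo (-(π / 2)) (π / 2)) :
    planeWeight 0 α (polarPoint r θ) = ENNReal.ofReal (Real.cos θ ^ α * r ^ α) := by
  rw [planeWeight, Real.rpow_zero, one_mul, polarPoint_one,
    Real.mul_rpow hr.le (cos_pos_of_mem_halfPi hθ).le, mul_comm]

theorem lintegral_cosMeasure (α : ℝ) (f : ℝ → ℝ≥0∞) : ∫⁻ t, f t ∂(cosMeasure α) =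
    ∫⁻ t in Ioo (-(π / 2)) (π / 2), ENNReal.ofReal (Real.cos t ^ α) * f t := by
  rw [cosMeasure_eq, lintegral_withDensity_eq_lintegral_mul_non_measurable _
    (measurable_toNNReal_cos_rpow α).coe_nnreal_ennreal (ae_of_all _ fun _ => ENNReal.coe_lt_top)]
  rfl

/-- The weighted length of the polar graph `r = ρ(θ)`. -/
theorem weightedPerimeter_polarSubgraph {α : ℝ} {ρ ρ' : ℝ → ℝ}
    (hpos : ∀ θ ∈ Ioo (-(π / 2)) (π / 2), 0 < ρ θ)
    (hd : ∀ θ ∈ Ioo (-(π / 2)) (π / 2), HasDerivAt ρ (ρ' θ) θ)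
    (hc : ContinuousOn ρ' (Ioo (-(π / 2)) (π / 2))) :
    weightedPerimeter 0 α (polarSubgraph ρ) =
      ∫⁻ θ, ENNReal.ofReal (ρ θ ^ α * √(ρ θ ^ 2 + ρ' θ ^ 2)) ∂(cosMeasure α) := by
  have hρ : ContinuousOn ρ (Ioo (-(π / 2)) (π / 2)) :=
    fun θ hθ => (hd θ hθ).continuousAt.continuousWithinAt
  let γ' : ℝ → Plane := fun θ =>
    !₂[ρ' θ * Real.sin θ + ρ θ * Real.cos θ, ρ' θ * Real.cos θ + ρ θ * -Real.sin θ]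
  have hγ : ∀ θ ∈ Ioo (-(π / 2)) (π / 2),
      HasDerivAt (fun θ => polarPoint (ρ θ) θ) (γ' θ) θ := fun θ hθ =>
    hasDerivAt_plane ((hd θ hθ).mul (Real.hasDerivAt_sin θ))
      ((hd θ hθ).mul (Real.hasDerivAt_cos θ))
  have hγ'c : ContinuousOn γ' (Ioo (-(π / 2)) (π / 2)) := by
    have h1 := Real.continuous_sin.continuousOn (s := Ioo (-(π / 2)) (π / 2))
    have h2 := Real.continuous_cos.continuousOn (s := Ioo (-(π / 2)) (π / 2))
    exact continuousOn_plane ((hc.mul h1).add (hρ.mul h2)) ((hc.mul h2).add (hρ.mul h1.neg))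
  have hnorm : ∀ θ, ‖γ' θ‖ = √(ρ θ ^ 2 + ρ' θ ^ 2) := by
    intro θ
    rw [EuclideanSpace.norm_eq, Fin.sum_univ_two]
    simp only [Real.norm_eq_abs, sq_abs]
    congr 1
    change (ρ' θ * Real.sin θ + ρ θ * Real.cos θ) ^ 2 +
      (ρ' θ * Real.cos θ + ρ θ * -Real.sin θ) ^ 2 = _
    linear_combination (ρ θ ^ 2 + ρ' θ ^ 2) * Real.sin_sq_add_cos_sq θ
  have hne : ∀ θ ∈ Ioo (-(π / 2)) (π / 2), γ' θ ≠ 0 := by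
    intro θ hθ
    have := hpos θ hθ
    rw [← norm_pos_iff, hnorm]
    positivity
  have hinj : InjOn (fun θ => polarPoint (ρ θ) θ) (Ioo (-(π / 2)) (π / 2)) := by
    intro x hx y hy hxy
    have := congrArg polarAngle hxy
    simpa only [polarAngle_polarPoint (hpos x hx) hx, polarAngle_polarPoint (hpos y hy) hy]
      using this
  rw [weightedPerimeter, frontier_polarSubgraph_inter hρ hpos,
    lintegral_image_hausdorffMeasure_one isOpen_Ioo hγ hγ'c hne hinj (measurable_planeWeight 0 α),
    lintegral_cosMeasure]
  refine setLIntegral_congr_fun measurableSet_Ioo fun θ hθ => ?_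
  have hP := Real.rpow_nonneg (cos_pos_of_mem_halfPi hθ).le α
  have hQ := Real.rpow_nonneg (hpos θ hθ).le α
  simp only [planeWeight_polarPoint (hpos θ hθ) hθ]
  rw [← ofReal_norm, hnorm, ← ENNReal.ofReal_mul (Real.sqrt_nonneg _), ← ENNReal.ofReal_mul hP]
  congr 1
  ring

/-- Integration in the plane in the polar coordinates given by `polarPoint`. -/
theorem lintegral_polarPoint {G : Plane → ℝ≥0∞} (hG : Measurable G) :
    ∫⁻ x, G x = ∫⁻ θ in Ioo (-π) π, ∫⁻ r in Ioi (0 : ℝ),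
      ENNReal.ofReal r * G (polarPoint r θ) := by
  -- The coordinates are swapped because `polarPoint` measures the angle from the second axis, while
  -- `polarCoord` measures it from the first.
  have hmp : MeasurePreserving (fun p : ℝ × ℝ => (!₂[p.2, p.1] : Plane)) :=
    ((PiLp.volume_preserving_toLp (Fin 2)).comp
      (volume_preserving_finTwoArrow ℝ).symm).comp
        (Measure.measurePreserving_swap (μ := (volume : Measure ℝ)) (ν := (volume : Measure ℝ)))
  rw [← hmp.lintegral_comp hG, ← lintegral_comp_polarCoord_symm, polarCoord_target,
    Measure.volume_eq_prod, ← Measure.prod_restrict, lintegral_prod_symm]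
  · rfl
  · have hcont : Continuous fun p : ℝ × ℝ => (polarPoint p.1 p.2) := by
      unfold polarPoint
      fun_prop
    exact ((measurable_fst.ennreal_ofReal).mul (hG.comp hcont.measurable)).aemeasurable

theorem lintegral_rpow_Ioo {p R : ℝ} (hp : -1 < p) (hR : 0 ≤ R) :
    ∫⁻ r in Ioo 0 R, ENNReal.ofReal (r ^ p) = ENNReal.ofReal (R ^ (p + 1) / (p + 1)) := by
  have hi := intervalIntegral.intervalIntegrable_rpow' (a := 0) (b := R) hp
  rw [intervalIntegrable_iff_integrableOn_Ioo_of_le hR] at hi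
  rw [← ofReal_integral_eq_lintegral_ofReal hi, ← integral_Ioc_eq_integral_Ioo,
    ← intervalIntegral.integral_of_le hR, integral_rpow (Or.inl hp),
    Real.zero_rpow (by linarith), sub_zero]
  exact (ae_restrict_iff' measurableSet_Ioo).2 (ae_of_all _ fun r hr => Real.rpow_nonneg hr.1.le p)

/-- The weighted volume of the region below the polar graph `r = ρ(θ)`. -/
theorem weightedVolume_polarSubgraph {α : ℝ} (hα : -2 < α) {ρ : ℝ → ℝ}
    (hρ : ContinuousOn ρ (Ioo (-(π / 2)) (π / 2)))
    (hpos : ∀ θ ∈ Ioo (-(π / 2)) (π / 2), 0 < ρ θ) :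
    weightedVolume 0 α (polarSubgraph ρ) =
      ∫⁻ θ, ENNReal.ofReal (ρ θ ^ (2 + α) / (2 + α)) ∂(cosMeasure α) := by
  have hpi := Real.pi_pos
  have hU := (isOpen_polarSubgraph hρ).measurableSet
  have hsub : polarSubgraph ρ ∩ upperHalf = polarSubgraph ρ :=
    inter_eq_left.2 fun x hx => hx.1
  rw [weightedVolume, hsub, ← lintegral_indicator hU,
    lintegral_polarPoint ((measurable_planeWeight 0 α).indicator hU), lintegral_cosMeasure,
    ← lintegral_indicator measurableSet_Ioo, ← lintegral_indicator measurableSet_Ioo]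
  refine lintegral_congr fun θ => ?_
  by_cases hθ : θ ∈ Ioo (-(π / 2)) (π / 2)
  · have hθ' : θ ∈ Ioo (-π) π := ⟨by linarith [hθ.1], by linarith [hθ.2]⟩
    rw [indicator_of_mem hθ, indicator_of_mem hθ']
    have hcos := Real.rpow_nonneg (cos_pos_of_mem_halfPi hθ).le α
    have h1 : ∀ r ∈ Ioi (0 : ℝ), ENNReal.ofReal r *
        (polarSubgraph ρ).indicator (planeWeight 0 α) (polarPoint r θ) =
        (Iio (ρ θ)).indicator
          (fun r => ENNReal.ofReal (Real.cos θ ^ α) * ENNReal.ofReal (r ^ (1 + α))) r := by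
      intro r hr
      have hr0 : 0 < r := hr
      have hiff : polarPoint r θ ∈ polarSubgraph ρ ↔ r < ρ θ := by
        rw [mem_polarSubgraph, norm_polarPoint hr0.le, polarAngle_polarPoint hr0 hθ]
        exact and_iff_right (polarPoint_mem_upperHalf hr0 hθ)
      by_cases hlt : r < ρ θ
      · rw [indicator_of_mem (hiff.2 hlt), indicator_of_mem (mem_Iio.2 hlt),
          planeWeight_polarPoint hr0 hθ, ← ENNReal.ofReal_mul hr0.le, ← ENNReal.ofReal_mul hcos,
          Real.rpow_add hr0, Real.rpow_one]
        congr 1; ring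
      · rw [indicator_of_notMem (fun h => hlt (hiff.1 h)),
          indicator_of_notMem (s := Iio (ρ θ)) hlt, mul_zero]
    -- The Jacobian turns `r^α` into `r^(1+α)`, which is integrable at `0` since `α > -2`.
    rw [setLIntegral_congr_fun measurableSet_Ioi h1, lintegral_indicator measurableSet_Iio,
      Measure.restrict_restrict measurableSet_Iio, Iio_inter_Ioi,
      lintegral_const_mul' _ _ ENNReal.ofReal_ne_top,
      lintegral_rpow_Ioo (by linarith) (hpos θ hθ).le]
    rw [show 1 + α + 1 = 2 + α by ring]
  · rw [indicator_of_notMem hθ]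
    by_cases hθ' : θ ∈ Ioo (-π) π
    · rw [indicator_of_mem hθ']
      refine (setLIntegral_congr_fun measurableSet_Ioi (g := fun _ => 0) fun r hr => ?_).trans
        (by simp)
      have hcos : Real.cos θ ≤ 0 := by
        rw [mem_Ioo, not_and_or, not_lt, not_lt] at hθ
        rcases hθ with h | h
        · rw [← Real.cos_neg]
          exact Real.cos_nonpos_of_pi_div_two_le_of_le (by linarith) (by linarith [hθ'.1])
        · exact Real.cos_nonpos_of_pi_div_two_le_of_le h (by linarith [hθ'.2])
      rw [indicator_of_notMem, mul_zero]
      intro h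
      have h2 : 0 < r * Real.cos θ := h.1
      exact absurd h2 (not_lt.2 (mul_nonpos_of_nonneg_of_nonpos (le_of_lt hr) hcos))
    · rw [indicator_of_notMem hθ']

/-! ### Differentiating the length density in `t`, with integrable bounds. -/

/-- Differentiation under the integral sign on a symmetric interval of parameters. -/
theorem hasDerivAt_integral_of_bound {μ : Measure ℝ} {F F' : ℝ → ℝ → ℝ} {b : ℝ → ℝ} {δ : ℝ}
    (hb : Integrable b μ) (hm : ∀ t, AEStronglyMeasurable (F t) μ)
    (hm' : ∀ t, AEStronglyMeasurable (F' t) μ)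
    (hF : ∀ᵐ x ∂μ, ∀ t, |t| < δ → |F t x| ≤ b x)
    (hF' : ∀ᵐ x ∂μ, ∀ t, |t| < δ → |F' t x| ≤ b x)
    (hd : ∀ᵐ x ∂μ, ∀ t, |t| < δ → HasDerivAt (fun τ => F τ x) (F' t x) t)
    {t : ℝ} (ht : |t| < δ) : HasDerivAt (fun τ => ∫ x, F τ x ∂μ) (∫ x, F' t x ∂μ) t := by
  have hs : {τ : ℝ | |τ| < δ} ∈ 𝓝 t := (isOpen_lt continuous_abs continuous_const).mem_nhds ht
  refine (hasDerivAt_integral_of_dominated_loc_of_deriv_le hs (Eventually.of_forall hm) ?_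
    (hm' t) ?_ hb ?_).2
  · exact hb.mono' (hm t) (hF.mono fun x hx => hx t ht)
  · exact hF'.mono fun x hx τ hτ => hx τ hτ
  · exact hd.mono fun x hx τ hτ => hx τ hτ

/-- The radius of the perturbed half-circle in a direction where `u` takes the value `U`. -/
noncomputable def perturbedRadius (s : ℝ → ℝ) (U t : ℝ) : ℝ := 1 + t * U + s t

/-- The speed of the perturbed half-circle, `P` being the value of `u'`. -/
noncomputable def perturbedSpeed (s : ℝ → ℝ) (U P t : ℝ) : ℝ :=
  √(perturbedRadius s U t ^ 2 + (t * P) ^ 2)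

/-- The derivative of `perturbedSpeed` in `t`. -/
noncomputable def perturbedSpeedDeriv (s : ℝ → ℝ) (U P t : ℝ) : ℝ :=
  (perturbedRadius s U t * (U + deriv s t) + t * P ^ 2) / perturbedSpeed s U P t

/-- The density of the weighted length of the perturbed half-circle. -/
noncomputable def lengthDensity (s : ℝ → ℝ) (β U P t : ℝ) : ℝ :=
  perturbedRadius s U t ^ β * perturbedSpeed s U P t

/-- The first derivative of `lengthDensity` in `t`. -/
noncomputable def lengthDensityDeriv (s : ℝ → ℝ) (β U P t : ℝ) : ℝ :=
  β * perturbedRadius s U t ^ (β - 1) * (U + deriv s t) * perturbedSpeed s U P t +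
    perturbedRadius s U t ^ β * perturbedSpeedDeriv s U P t

/-- The second derivative of `lengthDensity` in `t`. -/
noncomputable def lengthDensityDeriv₂ (s : ℝ → ℝ) (β U P t : ℝ) : ℝ :=
  β * (β - 1) * perturbedRadius s U t ^ (β - 2) * (U + deriv s t) ^ 2 * perturbedSpeed s U P t +
    β * perturbedRadius s U t ^ (β - 1) * deriv (deriv s) t * perturbedSpeed s U P t +
    2 * β * perturbedRadius s U t ^ (β - 1) * (U + deriv s t) * perturbedSpeedDeriv s U P t +
    perturbedRadius s U t ^ β *
      (((U + deriv s t) ^ 2 + perturbedRadius s U t * deriv (deriv s) t + P ^ 2 -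
        perturbedSpeedDeriv s U P t ^ 2) / perturbedSpeed s U P t)

section Pointwise

variable {s : ℝ → ℝ} {β U P t : ℝ}

theorem perturbedRadius_le_perturbedSpeed (s : ℝ → ℝ) (U P t : ℝ) :
    perturbedRadius s U t ≤ perturbedSpeed s U P t :=
  Real.le_sqrt_of_sq_le (by nlinarith [sq_nonneg (t * P)])

theorem abs_mul_le_perturbedSpeed (s : ℝ → ℝ) (U P t : ℝ) :
    |t * P| ≤ perturbedSpeed s U P t :=
  Real.abs_le_sqrt (by nlinarith [sq_nonneg (perturbedRadius s U t)])

theorem perturbedSpeed_sq (s : ℝ → ℝ) (U P t : ℝ) :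
    perturbedSpeed s U P t ^ 2 = perturbedRadius s U t ^ 2 + (t * P) ^ 2 :=
  Real.sq_sqrt (by positivity)

theorem hasDerivAt_perturbedRadius (hs : Differentiable ℝ s) :
    HasDerivAt (perturbedRadius s U) (U + deriv s t) t := by
  have h := (((hasDerivAt_id t).mul_const U).const_add 1).add (hs t).hasDerivAt
  exact h.congr_deriv (by simp)

theorem hasDerivAt_perturbedSpeed (hs : Differentiable ℝ s) (hρ : 0 < perturbedRadius s U t) :
    HasDerivAt (perturbedSpeed s U P) (perturbedSpeedDeriv s U P t) t := by
  have hq := hρ.trans_le (perturbedRadius_le_perturbedSpeed s U P t)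
  have h := (((hasDerivAt_perturbedRadius (U := U) (t := t) hs).pow 2).add
    (((hasDerivAt_id t).mul_const P).pow 2)).sqrt (by simp; positivity)
  refine h.congr_deriv ?_
  simp only [Pi.add_apply, Pi.pow_apply, id_eq]
  rw [perturbedSpeedDeriv, show √(perturbedRadius s U t ^ 2 + (t * P) ^ 2) =
    perturbedSpeed s U P t from rfl]
  field_simp
  ring

theorem hasDerivAt_perturbedSpeedDeriv (hs : Differentiable ℝ s)
    (hs' : Differentiable ℝ (deriv s)) (hρ : 0 < perturbedRadius s U t) :
    HasDerivAt (perturbedSpeedDeriv s U P)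
      (((U + deriv s t) ^ 2 + perturbedRadius s U t * deriv (deriv s) t + P ^ 2 -
        perturbedSpeedDeriv s U P t ^ 2) / perturbedSpeed s U P t) t := by
  have hq := hρ.trans_le (perturbedRadius_le_perturbedSpeed s U P t)
  have h := (((hasDerivAt_perturbedRadius (U := U) (t := t) hs).mul
    ((hs' t).hasDerivAt.const_add U)).add ((hasDerivAt_id t).mul_const (P ^ 2))).div
    (hasDerivAt_perturbedSpeed (P := P) hs hρ) hq.ne'
  refine h.congr_deriv ?_
  simp only [Pi.add_apply, Pi.mul_apply, id_eq]
  -- With `q` the speed and `A = q'`, the numerator of `A` is `A q`, so the quotient rule collapses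
  -- to (derivative of the numerator `- A²`) `/ q`.
  have hA : perturbedRadius s U t * (U + deriv s t) + t * P ^ 2 =
    perturbedSpeedDeriv s U P t * perturbedSpeed s U P t := by
    rw [perturbedSpeedDeriv]; field_simp
  rw [hA]
  field_simp

theorem hasDerivAt_lengthDensity (hs : Differentiable ℝ s) (hρ : 0 < perturbedRadius s U t) :
    HasDerivAt (lengthDensity s β U P) (lengthDensityDeriv s β U P t) t := by
  have h := ((hasDerivAt_perturbedRadius (U := U) (t := t) hs).rpow_const (p := β)
    (Or.inl hρ.ne')).mul (hasDerivAt_perturbedSpeed (P := P) hs hρ)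
  refine h.congr_deriv ?_
  rw [lengthDensityDeriv]
  ring

theorem hasDerivAt_lengthDensityDeriv (hs : Differentiable ℝ s)
    (hs' : Differentiable ℝ (deriv s)) (hρ : 0 < perturbedRadius s U t) :
    HasDerivAt (lengthDensityDeriv s β U P) (lengthDensityDeriv₂ s β U P t) t := by
  have hR := hasDerivAt_perturbedRadius (U := U) (t := t) hs
  have hq := hasDerivAt_perturbedSpeed (P := P) hs hρ
  have hA := hasDerivAt_perturbedSpeedDeriv (P := P) hs hs' hρ
  have h := ((((hR.rpow_const (p := β - 1) (Or.inl hρ.ne')).const_mul β).mul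
    ((hs' t).hasDerivAt.const_add U)).mul hq).add
    ((hR.rpow_const (p := β) (Or.inl hρ.ne')).mul hA)
  refine h.congr_deriv ?_
  simp only [Pi.mul_apply]
  rw [lengthDensityDeriv₂, show β - 1 - 1 = β - 2 by ring]
  ring

theorem rpow_le_two_rpow {ρ γ B : ℝ} (h1 : 1 / 2 ≤ ρ) (h2 : ρ ≤ 2) (hB : |γ| ≤ B) :
    ρ ^ γ ≤ 2 ^ B := by
  have hρ : 0 < ρ := by linarith
  rcases le_total 0 γ with h | h
  · calc ρ ^ γ ≤ 2 ^ γ := Real.rpow_le_rpow hρ.le h2 h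
      _ ≤ 2 ^ B := Real.rpow_le_rpow_of_exponent_le (by norm_num) ((le_abs_self γ).trans hB)
  · calc ρ ^ γ ≤ (1 / 2) ^ γ := Real.rpow_le_rpow_of_nonpos (by norm_num) h1 h
      _ = 2 ^ (-γ) := by rw [one_div, Real.inv_rpow (by norm_num), Real.rpow_neg (by norm_num)]
      _ ≤ 2 ^ B := Real.rpow_le_rpow_of_exponent_le (by norm_num) ((neg_le_abs γ).trans hB)

/-- Both `ρ` and `|t P|` are at most the speed, so the division in `perturbedSpeedDeriv` cancels and
leaves a bound linear in `|P|`. -/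
theorem perturbedSpeed_bounds {C : ℝ} (hρ : 0 < perturbedRadius s U t)
    (h2 : perturbedRadius s U t ≤ 2) (ht : |t| ≤ 1) (hv : |U + deriv s t| ≤ C) :
    perturbedSpeed s U P t ≤ 2 + |P| ∧ |perturbedSpeedDeriv s U P t| ≤ C + |P| := by
  have hρq := perturbedRadius_le_perturbedSpeed s U P t
  have htq := abs_mul_le_perturbedSpeed s U P t
  have hq := hρ.trans_le hρq
  constructor
  · have htP : |t * P| ≤ |P| := by
      rw [abs_mul]; exact mul_le_of_le_one_left (abs_nonneg P) ht
    have h4 : perturbedSpeed s U P t ^ 2 ≤ (perturbedRadius s U t + |t * P|) ^ 2 := by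
      rw [perturbedSpeed_sq, add_sq, sq_abs]
      linarith [mul_nonneg hρ.le (abs_nonneg (t * P))]
    have h5 := abs_le_of_sq_le_sq' h4 (by positivity)
    linarith [h5.2]
  · rw [perturbedSpeedDeriv, abs_div, abs_of_pos hq, div_le_iff₀ hq]
    calc |perturbedRadius s U t * (U + deriv s t) + t * P ^ 2|
        ≤ |perturbedRadius s U t * (U + deriv s t)| + |t * P ^ 2| := abs_add_le _ _
      _ = perturbedRadius s U t * |U + deriv s t| + |t * P| * |P| := by
          rw [abs_mul, abs_of_pos hρ, ← abs_mul (t * P)]; congr 2; ring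
      _ ≤ perturbedSpeed s U P t * C + perturbedSpeed s U P t * |P| := by gcongr
      _ = _ := by ring

/-- The growth is only quadratic in `P`, which is what square integrability of `u'` can absorb.
Dividing by `q ≥ 1/2` costs a factor `2`. -/
theorem abs_speed_second_deriv_le {ρ v σ A q C : ℝ} (hC : 1 ≤ C) (h1 : 1 / 2 ≤ ρ) (h2 : ρ ≤ 2)
    (hq : ρ ≤ q) (hv : |v| ≤ C) (hσ : |σ| ≤ C) (hA : |A| ≤ C + |P|) :
    |(v ^ 2 + ρ * σ + P ^ 2 - A ^ 2) / q| ≤ 12 * C ^ 2 * (1 + P ^ 2) := by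
  have hρ : 0 < ρ := by linarith
  have hq0 : 0 < q := by linarith
  have hA2 : A ^ 2 ≤ 2 * C ^ 2 + 2 * P ^ 2 := by
    have h4 : A ^ 2 ≤ (C + |P|) ^ 2 := by
      rw [← sq_abs A]; exact pow_le_pow_left₀ (abs_nonneg _) hA 2
    linarith [sq_nonneg (C - |P|), sq_abs P, sub_sq C |P|, add_sq C |P|]
  have hv2 : v ^ 2 ≤ C ^ 2 := by
    rw [← sq_abs v]; exact pow_le_pow_left₀ (abs_nonneg _) hv 2
  have h6 : |ρ * σ| ≤ 2 * C := by
    rw [abs_mul, abs_of_pos hρ]; gcongr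
  have h6' := abs_le.1 h6
  have e3 : C ≤ C ^ 2 := le_self_pow₀ hC two_ne_zero
  have e5 : P ^ 2 ≤ C ^ 2 * P ^ 2 :=
    le_mul_of_one_le_left (sq_nonneg P) (one_le_pow₀ hC)
  rw [abs_div, abs_of_pos hq0, div_le_iff₀ hq0]
  calc |v ^ 2 + ρ * σ + P ^ 2 - A ^ 2| ≤ 6 * C ^ 2 + 6 * (C ^ 2 * P ^ 2) := by
        rw [abs_le]
        constructor <;> linarith [sq_nonneg A, sq_nonneg P, sq_nonneg v]
    _ = 12 * C ^ 2 * (1 + P ^ 2) * (1 / 2) := by ring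
    _ ≤ 12 * C ^ 2 * (1 + P ^ 2) * q := by gcongr; linarith

/-- Uniform bounds for the density and its derivatives. -/
theorem lengthDensity_bounds (β : ℝ) {C : ℝ} (hC : 1 ≤ C) : ∃ K : ℝ,
    ∀ (s : ℝ → ℝ) (U P t : ℝ), 1 / 2 ≤ perturbedRadius s U t → perturbedRadius s U t ≤ 2 →
      |t| ≤ 1 → |U + deriv s t| ≤ C → |deriv (deriv s) t| ≤ C →
      |lengthDensity s β U P t| ≤ K * (1 + P ^ 2) ∧
      |lengthDensityDeriv s β U P t| ≤ K * (1 + P ^ 2) ∧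
      |lengthDensityDeriv₂ s β U P t| ≤ K * (1 + P ^ 2) := by
  -- One constant bounds `ρ^β`, `ρ^(β-1)` and `ρ^(β-2)` for `ρ` in `[1/2, 2]`.
  obtain ⟨R, hR⟩ : ∃ R : ℝ, R = 2 ^ (|β| + 2) := ⟨_, rfl⟩
  have hR0 : 0 < R := hR ▸ by positivity
  refine ⟨3 * R + (|β| * R * C * 3 + R * (2 * C)) + (|β * (β - 1)| * R * C ^ 2 * 3 +
    |β| * R * C * 3 + 2 * |β| * R * C * (2 * C) + R * (12 * C ^ 2)),
    fun s U P t h1 h2 ht hv hσ => ?_⟩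
  have hρ : 0 < perturbedRadius s U t := by linarith
  have hr : ∀ γ : ℝ, |γ| ≤ |β| + 2 → |perturbedRadius s U t ^ γ| ≤ R := fun γ hγ => by
    rw [abs_of_pos (Real.rpow_pos_of_pos hρ γ), hR]
    exact rpow_le_two_rpow h1 h2 hγ
  have hr0 := hr β (by linarith)
  have hr1 := hr (β - 1) (by linarith [abs_sub β 1, abs_one (α := ℝ)])
  have hr2 := hr (β - 2) (by linarith [abs_sub β 2, abs_two (α := ℝ)])
  have hPW : |P| ≤ 1 + P ^ 2 := by nlinarith [sq_abs P, sq_nonneg (|P| - 1), abs_nonneg P]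
  have hW1 : 1 ≤ 1 + P ^ 2 := by linarith [sq_nonneg P]
  have hρq := perturbedRadius_le_perturbedSpeed s U P t
  obtain ⟨hq3, hA0⟩ := perturbedSpeed_bounds (P := P) hρ h2 ht hv
  have hN := abs_speed_second_deriv_le (P := P) hC h1 h2 hρq hv hσ hA0
  have hv2 : |(U + deriv s t) ^ 2| ≤ C ^ 2 := by
    rw [abs_pow]; exact pow_le_pow_left₀ (abs_nonneg _) hv 2
  have hq : |perturbedSpeed s U P t| ≤ 3 * (1 + P ^ 2) := by
    rw [abs_of_pos (hρ.trans_le hρq)]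
    linarith
  have hC0 : 0 ≤ C := by linarith
  have hA : |perturbedSpeedDeriv s U P t| ≤ 2 * C * (1 + P ^ 2) := by
    have hCW1 : C ≤ C * (1 + P ^ 2) := le_mul_of_one_le_right hC0 hW1
    have hCW2 : 1 + P ^ 2 ≤ C * (1 + P ^ 2) := le_mul_of_one_le_left (by linarith) hC
    linarith
  generalize 1 + P ^ 2 = W at *
  have hW0 : 0 ≤ W := by linarith
  have k0 : |lengthDensity s β U P t| ≤ R * (3 * W) := by
    rw [lengthDensity, abs_mul]
    gcongr
  have k1 : |lengthDensityDeriv s β U P t| ≤ |β| * R * C * (3 * W) + R * (2 * C * W) := by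
    rw [lengthDensityDeriv]
    refine (abs_add_le _ _).trans ?_
    rw [abs_mul, abs_mul, abs_mul, abs_mul]
    gcongr
  have k2 : |lengthDensityDeriv₂ s β U P t| ≤ |β * (β - 1)| * R * C ^ 2 * (3 * W) +
      |β| * R * C * (3 * W) + 2 * |β| * R * C * (2 * C * W) + R * (12 * C ^ 2 * W) := by
    rw [lengthDensityDeriv₂]
    refine (abs_add_le _ _).trans (add_le_add ((abs_add_le _ _).trans
      (add_le_add ((abs_add_le _ _).trans (add_le_add ?_ ?_)) ?_)) ?_)
    · rw [abs_mul, abs_mul, abs_mul]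
      gcongr
    · rw [abs_mul, abs_mul, abs_mul]
      gcongr
    · rw [abs_mul, abs_mul, abs_mul, abs_mul, abs_two]
      gcongr
    · rw [abs_mul]
      gcongr
  have p0 : 0 ≤ R * (3 * W) := by positivity
  have p1 : 0 ≤ |β| * R * C * (3 * W) + R * (2 * C * W) := by positivity
  have p2 : 0 ≤ |β * (β - 1)| * R * C ^ 2 * (3 * W) +
      |β| * R * C * (3 * W) + 2 * |β| * R * C * (2 * C * W) + R * (12 * C ^ 2 * W) := by positivity
  refine ⟨?_, ?_, ?_⟩ <;> linarith

theorem lengthDensityDeriv_zero (hs0 : s 0 = 0) :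
    lengthDensityDeriv s β U P 0 = (β + 1) * (U + deriv s 0) := by
  have hρ : perturbedRadius s U 0 = 1 := by simp [perturbedRadius, hs0]
  have hq : perturbedSpeed s U P 0 = 1 := by simp [perturbedSpeed, hρ]
  simp only [lengthDensityDeriv, perturbedSpeedDeriv, hρ, hq, Real.one_rpow]
  ring

theorem lengthDensityDeriv₂_zero (hs0 : s 0 = 0) :
    lengthDensityDeriv₂ s β U P 0 =
      β * (β + 1) * (U + deriv s 0) ^ 2 + (β + 1) * deriv (deriv s) 0 + P ^ 2 := by
  have hρ : perturbedRadius s U 0 = 1 := by simp [perturbedRadius, hs0]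
  have hq : perturbedSpeed s U P 0 = 1 := by simp [perturbedSpeed, hρ]
  simp only [lengthDensityDeriv₂, perturbedSpeedDeriv, hρ, hq, Real.one_rpow]
  ring

end Pointwise

/-- The bounds under which the perturbation with time `t` is controlled in every direction in
which the absolute value of `u` is at most `M`. -/
theorem exists_perturbation_bounds {s : ℝ → ℝ} (hs : ContDiff ℝ 2 s) (hs0 : s 0 = 0) {M : ℝ}
    (hM : 0 ≤ M) : ∃ δ > 0, ∃ C : ℝ, 1 ≤ C ∧ ∀ U t : ℝ, |U| ≤ M → |t| < δ →
      1 / 2 ≤ perturbedRadius s U t ∧ perturbedRadius s U t ≤ 2 ∧ |t| ≤ 1 ∧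
      |U + deriv s t| ≤ C ∧ |deriv (deriv s) t| ≤ C := by
  have hs1 : ContDiff ℝ 1 (deriv s) := hs.deriv' (n := 1)
  have hs2 : Continuous (deriv (deriv s)) := hs1.continuous_deriv le_rfl
  have e0 : ∀ᶠ t in 𝓝 (0 : ℝ), |s t| < 1 / 4 := by
    have := hs.continuous.abs.continuousAt (x := 0)
    refine this.eventually_lt_const ?_
    simp [hs0]
  have e1 : ∀ᶠ t in 𝓝 (0 : ℝ), |deriv s t| < |deriv s 0| + 1 :=
    hs1.continuous.abs.continuousAt.eventually_lt_const (by linarith)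
  have e2 : ∀ᶠ t in 𝓝 (0 : ℝ), |deriv (deriv s) t| < |deriv (deriv s) 0| + 1 :=
    hs2.abs.continuousAt.eventually_lt_const (by linarith)
  obtain ⟨ε, hε, hball⟩ := Metric.eventually_nhds_iff.1 (e0.and (e1.and e2))
  -- The second bound on `δ` gives `|t U| ≤ 1/4`; together with `|s t| < 1/4` the radius stays
  -- within `1/2` of `1`.
  refine ⟨min ε (1 / (4 * (M + 1))), lt_min hε (by positivity),
    M + |deriv s 0| + |deriv (deriv s) 0| + 1, ?_, fun U t hU ht => ?_⟩
  · linarith [abs_nonneg (deriv s 0), abs_nonneg (deriv (deriv s) 0)]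
  obtain ⟨h0, h1, h2⟩ := hball (y := t) (by
    rw [dist_zero_right]; exact ht.trans_le (min_le_left _ _))
  have htM : |t| * (4 * (M + 1)) < 1 := by
    rw [← lt_div_iff₀ (by positivity)]
    exact ht.trans_le (min_le_right _ _)
  have ht0 := abs_nonneg t
  have htM0 := mul_nonneg ht0 hM
  have htU : |t * U| ≤ 1 / 4 := by
    rw [abs_mul]
    have : |t| * |U| ≤ |t| * M := by gcongr
    linarith
  have a1 := abs_le.1 htU
  have a2 := abs_lt.1 h0
  refine ⟨?_, ?_, ?_, ?_, ?_⟩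
  · rw [perturbedRadius]; linarith
  · rw [perturbedRadius]; linarith
  · linarith
  · linarith [abs_add_le U (deriv s t), abs_nonneg (deriv (deriv s) 0)]
  · linarith [abs_nonneg (deriv s 0)]

theorem measurable_lengthDensity (s : ℝ → ℝ) (β t : ℝ) :
    Measurable fun z : ℝ × ℝ => lengthDensity s β z.1 z.2 t := by
  unfold lengthDensity perturbedSpeed perturbedRadius
  fun_prop

theorem measurable_lengthDensityDeriv (s : ℝ → ℝ) (β t : ℝ) :
    Measurable fun z : ℝ × ℝ => lengthDensityDeriv s β z.1 z.2 t := by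
  unfold lengthDensityDeriv perturbedSpeedDeriv perturbedSpeed perturbedRadius
  fun_prop

theorem measurable_lengthDensityDeriv₂ (s : ℝ → ℝ) (β t : ℝ) :
    Measurable fun z : ℝ × ℝ => lengthDensityDeriv₂ s β z.1 z.2 t := by
  unfold lengthDensityDeriv₂ perturbedSpeedDeriv perturbedSpeed perturbedRadius
  fun_prop

/-- The integral of the length density is twice differentiable in the parameter. -/
theorem hasDerivAt_integral_lengthDensity {μ : Measure ℝ} [IsFiniteMeasure μ] {s u p : ℝ → ℝ}
    (hs : ContDiff ℝ 2 s) (β : ℝ) (hu : AEStronglyMeasurable u μ) (hp : MemLp p 2 μ) {δ C : ℝ}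
    (hC : 1 ≤ C)
    (hb : ∀ᵐ x ∂μ, ∀ t, |t| < δ →
      1 / 2 ≤ perturbedRadius s (u x) t ∧ perturbedRadius s (u x) t ≤ 2 ∧ |t| ≤ 1 ∧
      |u x + deriv s t| ≤ C ∧ |deriv (deriv s) t| ≤ C) {t : ℝ} (ht : |t| < δ) :
    Integrable (fun x => lengthDensity s β (u x) (p x) t) μ ∧
      HasDerivAt (fun τ => ∫ x, lengthDensity s β (u x) (p x) τ ∂μ)
        (∫ x, lengthDensityDeriv s β (u x) (p x) t ∂μ) t ∧
      HasDerivAt (fun τ => ∫ x, lengthDensityDeriv s β (u x) (p x) τ ∂μ)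
        (∫ x, lengthDensityDeriv₂ s β (u x) (p x) t ∂μ) t := by
  have hs' : Differentiable ℝ s := hs.differentiable (by norm_num)
  have hs'' : Differentiable ℝ (deriv s) := (hs.deriv' (n := 1)).differentiable one_ne_zero
  obtain ⟨K, hK⟩ := lengthDensity_bounds β hC
  have hup : AEMeasurable (fun x => (u x, p x)) μ := hu.aemeasurable.prodMk hp.1.aemeasurable
  have hKi : Integrable (fun x => K * (1 + p x ^ 2)) μ :=
    ((integrable_const 1).add hp.integrable_sq).const_mul K
  have m0 : ∀ τ, AEStronglyMeasurable (fun x => lengthDensity s β (u x) (p x) τ) μ := fun τ =>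
    ((measurable_lengthDensity s β τ).comp_aemeasurable hup).aestronglyMeasurable
  have m1 : ∀ τ, AEStronglyMeasurable (fun x => lengthDensityDeriv s β (u x) (p x) τ) μ :=
    fun τ => ((measurable_lengthDensityDeriv s β τ).comp_aemeasurable hup).aestronglyMeasurable
  have m2 : ∀ τ, AEStronglyMeasurable (fun x => lengthDensityDeriv₂ s β (u x) (p x) τ) μ :=
    fun τ => ((measurable_lengthDensityDeriv₂ s β τ).comp_aemeasurable hup).aestronglyMeasurable
  have hKb : ∀ᵐ x ∂μ, ∀ τ, |τ| < δ → _ := hb.mono fun x hx τ hτ =>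
    hK s (u x) (p x) τ (hx τ hτ).1 (hx τ hτ).2.1 (hx τ hτ).2.2.1 (hx τ hτ).2.2.2.1
      (hx τ hτ).2.2.2.2
  have b0 := hKb.mono fun x hx τ hτ => (hx τ hτ).1
  have b1 := hKb.mono fun x hx τ hτ => (hx τ hτ).2.1
  have b2 := hKb.mono fun x hx τ hτ => (hx τ hτ).2.2
  refine ⟨hKi.mono' (m0 t) (b0.mono fun x hx => hx t ht), ?_, ?_⟩
  · exact hasDerivAt_integral_of_bound hKi m0 m1 b0 b1 (hb.mono fun x hx τ hτ =>
      hasDerivAt_lengthDensity hs' (by linarith [(hx τ hτ).1])) ht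
  · exact hasDerivAt_integral_of_bound hKi m1 m2 b1 b2 (hb.mono fun x hx τ hτ =>
      hasDerivAt_lengthDensityDeriv hs' hs'' (by linarith [(hx τ hτ).1])) ht

/-! ### The second variation at the half-disc. -/

theorem eq_add_integral_deriv {u : ℝ → ℝ} (hu : ContDiffOn ℝ 2 u (Ioo (-(π / 2)) (π / 2)))
    {x : ℝ} (hx : x ∈ Ioo (-(π / 2)) (π / 2)) : u x = u 0 + ∫ t in (0 : ℝ)..x, deriv u t := by
  have hpi := Real.pi_pos
  have h0 : (0 : ℝ) ∈ Ioo (-(π / 2)) (π / 2) := ⟨by linarith, by linarith⟩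
  have hsub : uIcc 0 x ⊆ Ioo (-(π / 2)) (π / 2) := by
    exact ordConnected_Ioo.uIcc_subset h0 hx
  have hc : ContinuousOn (deriv u) (Ioo (-(π / 2)) (π / 2)) :=
    hu.continuousOn_deriv_of_isOpen isOpen_Ioo (by norm_num)
  rw [intervalIntegral.integral_deriv_eq_sub (fun y hy =>
    (hu.differentiableOn (by norm_num)).differentiableAt (isOpen_Ioo.mem_nhds (hsub hy)))
    (hc.mono hsub).intervalIntegrable]
  ring

/-- Regularity of `u` is assumed only inside the interval. Boundedness up to the ends holds because
`u'`, being in `L²(dν)`, is Lebesgue integrable; it lets one `δ` serve all directions. -/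
theorem exists_bound_of_memLp_deriv {α : ℝ} (hα : α ∈ Ioo (-1 : ℝ) 0) {u : ℝ → ℝ}
    (hu : ContDiffOn ℝ 2 u (Ioo (-(π / 2)) (π / 2))) (hp : MemLp (deriv u) 2 (cosMeasure α)) :
    ∃ M : ℝ, 0 ≤ M ∧ ∀ x ∈ Ioo (-(π / 2)) (π / 2), |u x| ≤ M := by
  have hpi := Real.pi_pos
  have hle : -(π / 2) ≤ π / 2 := by linarith
  have hac := (intervalIntegrable_of_memLp_cosMeasure hα
    hp).absolutelyContinuousOnInterval_intervalIntegral (c := 0)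
    (by rw [uIcc_of_le hle]; exact ⟨by linarith, by linarith⟩)
  obtain ⟨M, hM⟩ := hac.exists_bound
  rw [uIcc_of_le hle] at hM
  refine ⟨|u 0| + |M|, by positivity, fun x hx => ?_⟩
  rw [eq_add_integral_deriv hu hx]
  refine (abs_add_le _ _).trans (add_le_add le_rfl ?_)
  exact (hM x (Ioo_subset_Icc_self hx)).trans (le_abs_self M)

theorem second_variation_halfDisc {α : ℝ} (hα : α ∈ Ioo (-1 : ℝ) 0) {u s : ℝ → ℝ}
    (hu : ContDiffOn ℝ 2 u (Ioo (-(π / 2)) (π / 2))) (hp : MemLp (deriv u) 2 (cosMeasure α))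
    (hs : ContDiff ℝ 2 s) (hs0 : s 0 = 0)
    (hvol : ∃ t₀ > 0, ∀ t : ℝ, |t| < t₀ →
        weightedVolume 0 α (perturbedHalfDisc u s t) = weightedVolume 0 α halfDisc) :
    (∀ᶠ t in 𝓝 (0 : ℝ), weightedPerimeter 0 α (perturbedHalfDisc u s t) ≠ ⊤) ∧
      (∀ᶠ t in 𝓝 (0 : ℝ), DifferentiableAt ℝ (perimeterFunctional 0 α u s) t) ∧
      DifferentiableAt ℝ (deriv (perimeterFunctional 0 α u s)) 0 ∧
      0 ≤ deriv (deriv (perimeterFunctional 0 α u s)) 0 := by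
  have hfin := isFiniteMeasure_cosMeasure hα
  have h1 : 0 < 1 + α := by linarith [hα.1]
  have h2 : 0 < 2 + α := by linarith
  obtain ⟨M, hM0, hM⟩ := exists_bound_of_memLp_deriv hα hu hp
  obtain ⟨δ, hδ, C, hC, hbd⟩ := exists_perturbation_bounds hs hs0 hM0
  have hb : ∀ᵐ x ∂(cosMeasure α), ∀ t, |t| < δ →
      1 / 2 ≤ perturbedRadius s (u x) t ∧ perturbedRadius s (u x) t ≤ 2 ∧ |t| ≤ 1 ∧
      |u x + deriv s t| ≤ C ∧ |deriv (deriv s) t| ≤ C :=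
    (ae_cosMeasure_iff α).2 (ae_of_all _ fun x hx t ht => hbd _ t (hM x hx) ht)
  have hum : AEStronglyMeasurable u (cosMeasure α) :=
    (hu.continuousOn.aestronglyMeasurable measurableSet_Ioo).mono_ac
      (cosMeasure_absolutelyContinuous α)
  have hpos : ∀ t, |t| < δ → ∀ x ∈ Ioo (-(π / 2)) (π / 2), 0 < perturbedRadius s (u x) t :=
    fun t ht x hx => by linarith [(hbd _ t (hM x hx) ht).1]
  have hnear : ∀ {ε : ℝ}, 0 < ε → ∀ᶠ t in 𝓝 (0 : ℝ), |t| < ε := fun {ε} hε =>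
    continuous_abs.continuousAt.eventually_lt_const (by simpa using hε)
  have hL := fun t ht =>
    hasDerivAt_integral_lengthDensity hs α hum hp hC hb (t := t) ht
  -- With exponent `1 + α` and `P = 0` the length density is `ρ^(2+α)`, so the same lemma
  -- differentiates the volume.
  have hV := fun t ht => hasDerivAt_integral_lengthDensity hs (1 + α) hum
    (MemLp.zero (p := 2) (μ := cosMeasure α) (ε := ℝ)) hC hb (t := t) ht
  simp only [Pi.zero_apply] at hV
  -- the perimeter
  have hper : ∀ t, |t| < δ → weightedPerimeter 0 α (perturbedHalfDisc u s t) =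
      ∫⁻ x, ENNReal.ofReal (lengthDensity s α (u x) (deriv u x) t) ∂(cosMeasure α) := by
    intro t ht
    refine weightedPerimeter_polarSubgraph (ρ := fun x => perturbedRadius s (u x) t)
      (ρ' := fun x => t * deriv u x) (hpos t ht) (fun x hx => ?_) ?_
    · have := (hu.differentiableOn (by norm_num)).differentiableAt (isOpen_Ioo.mem_nhds hx)
      exact ((this.hasDerivAt.const_mul t).const_add 1).add_const (s t)
    · exact continuousOn_const.mul (hu.continuousOn_deriv_of_isOpen isOpen_Ioo (by norm_num))
  have hnn : ∀ t, |t| < δ →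
      0 ≤ᵐ[cosMeasure α] fun x => lengthDensity s α (u x) (deriv u x) t := fun t ht =>
    hb.mono fun x hx => mul_nonneg
      (Real.rpow_nonneg (by linarith [(hx t ht).1]) α) (Real.sqrt_nonneg _)
  have hJ : ∀ t, |t| < δ → perimeterFunctional 0 α u s t =
      ∫ x, lengthDensity s α (u x) (deriv u x) t ∂(cosMeasure α) := by
    intro t ht
    rw [perimeterFunctional, hper t ht,
      integral_eq_lintegral_of_nonneg_ae (hnn t ht) (hL t ht).1.1]
  have hJev : ∀ t, |t| < δ → perimeterFunctional 0 α u s =ᶠ[𝓝 t]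
      fun τ => ∫ x, lengthDensity s α (u x) (deriv u x) τ ∂(cosMeasure α) := fun t ht =>
    Filter.eventually_of_mem ((isOpen_lt continuous_abs continuous_const).mem_nhds ht) hJ
  have hJd : ∀ t, |t| < δ → HasDerivAt (perimeterFunctional 0 α u s)
      (∫ x, lengthDensityDeriv s α (u x) (deriv u x) t ∂(cosMeasure α)) t := fun t ht =>
    (hL t ht).2.1.congr_of_eventuallyEq (hJev t ht)
  have hδ0 : |(0 : ℝ)| < δ := by simpa using hδ
  have hJdd : HasDerivAt (deriv (perimeterFunctional 0 α u s))
      (∫ x, lengthDensityDeriv₂ s α (u x) (deriv u x) 0 ∂(cosMeasure α)) 0 := by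
    refine (hL 0 hδ0).2.2.congr_of_eventuallyEq ?_
    filter_upwards [hnear hδ] with t ht using (hJd t ht).deriv
  refine ⟨?_, ?_, hJdd.differentiableAt, ?_⟩
  · filter_upwards [hnear hδ] with t ht
    rw [hper t ht]
    exact (hL t ht).1.lintegral_lt_top.ne
  · filter_upwards [hnear hδ] with t ht using (hJd t ht).differentiableAt
  -- the volume constraint
  obtain ⟨t₀, ht₀, hvol⟩ := hvol
  have hVeq : ∀ t, |t| < δ → |t| < t₀ →
      ∫ x, lengthDensity s (1 + α) (u x) 0 t ∂(cosMeasure α) =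
        (2 + α) * (weightedVolume 0 α halfDisc).toReal := by
    intro t ht htt
    have hρc : ContinuousOn (fun x => perturbedRadius s (u x) t) (Ioo (-(π / 2)) (π / 2)) :=
      (continuousOn_const.add (continuousOn_const.mul hu.continuousOn)).add continuousOn_const
    have hpt : ∀ᵐ x ∂(cosMeasure α), perturbedRadius s (u x) t ^ (2 + α) / (2 + α) =
        (2 + α)⁻¹ * lengthDensity s (1 + α) (u x) 0 t := by
      filter_upwards [hb] with x hx
      have hr : 0 < perturbedRadius s (u x) t := by linarith [(hx t ht).1]
      rw [lengthDensity, perturbedSpeed, mul_zero, zero_pow two_ne_zero, add_zero,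
        Real.sqrt_sq hr.le, ← Real.rpow_add_one hr.ne', show 1 + α + 1 = 2 + α by ring,
        div_eq_inv_mul]
    rw [← hvol t htt, perturbedHalfDisc_eq_polarSubgraph]
    change _ = (2 + α) * (weightedVolume 0 α
      (polarSubgraph fun x => perturbedRadius s (u x) t)).toReal
    rw [weightedVolume_polarSubgraph (by linarith) hρc (hpos t ht),
      ← integral_eq_lintegral_of_nonneg_ae, integral_congr_ae hpt, integral_const_mul,
      mul_inv_cancel_left₀ h2.ne']
    · exact hb.mono fun x hx => div_nonneg
        (Real.rpow_nonneg (by linarith [(hx t ht).1]) _) h2.le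
    · exact ((hV t ht).1.1.const_mul (2 + α)⁻¹).congr (hpt.mono fun x hx => hx.symm)
  have hδ' : 0 < min δ t₀ := lt_min hδ ht₀
  -- The first derivative of the volume vanishes on a whole neighbourhood, so it can be
  -- differentiated again at `0`.
  have hV1 : ∀ t, |t| < min δ t₀ →
      ∫ x, lengthDensityDeriv s (1 + α) (u x) 0 t ∂(cosMeasure α) = 0 := by
    intro t ht
    refine (hV t (ht.trans_le (min_le_left _ _))).2.1.unique ?_
    refine (hasDerivAt_const t
      ((2 + α) * (weightedVolume 0 α halfDisc).toReal)).congr_of_eventuallyEq ?_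
    filter_upwards [(isOpen_lt continuous_abs continuous_const).mem_nhds ht] with τ hτ
    exact hVeq τ (lt_of_lt_of_le hτ (min_le_left _ _)) (lt_of_lt_of_le hτ (min_le_right _ _))
  have hV2 : ∫ x, lengthDensityDeriv₂ s (1 + α) (u x) 0 0 ∂(cosMeasure α) = 0 := by
    refine (hV 0 hδ0).2.2.unique ?_
    refine (hasDerivAt_const (0 : ℝ) (0 : ℝ)).congr_of_eventuallyEq ?_
    filter_upwards [hnear hδ'] with τ hτ using hV1 τ hτ
  have hV1' := hV1 0 (by simpa using hδ')
  -- evaluation at `t = 0` and the Wirtinger inequality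
  rw [hJdd.deriv]
  simp only [lengthDensityDeriv_zero hs0, lengthDensityDeriv₂_zero hs0] at hV1' hV2 ⊢
  have hvi : Integrable (fun x => (u x + deriv s 0) ^ 2) (cosMeasure α) := by
    refine Integrable.mono' (integrable_const (C ^ 2)) ((hum.add_const _).pow 2) ?_
    filter_upwards [hb] with x hx
    rw [norm_pow]
    exact pow_le_pow_left₀ (norm_nonneg _) (hx 0 hδ0).2.2.2.1 2
  have hci : ∀ c : ℝ, Integrable (fun _ : ℝ => c) (cosMeasure α) := fun c => integrable_const c
  rw [integral_const_mul] at hV1'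
  have hmean : ∫ x, (u x + deriv s 0) ∂(cosMeasure α) = 0 := by
    rcases mul_eq_zero.1 hV1' with h | h
    · linarith
    · exact h
  -- This writes `v = u + s'(0)` as a primitive of `u'` based at `0`, the form required by
  -- `weighted_wirtinger`.
  have hrep : ∀ᵐ x ∂(cosMeasure α), u x + deriv s 0 =
      (u 0 + deriv s 0) + ∫ t in (0 : ℝ)..x, deriv u t :=
    (ae_cosMeasure_iff α).2 (ae_of_all _ fun x hx => by rw [eq_add_integral_deriv hu hx]; ring)
  have hw := weighted_wirtinger hα hp (C := u 0 + deriv s 0)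
    ((integral_congr_ae hrep).symm.trans hmean)
  rw [← integral_congr_ae (hrep.mono fun x hx => congrArg (· ^ 2) hx)] at hw
  simp only [ne_eq, OfNat.ofNat_ne_zero, not_false_eq_true, zero_pow, add_zero] at hV2
  rw [integral_add (hvi.const_mul _) (hci _), integral_const_mul] at hV2
  have hsum : Integrable (fun x => α * (α + 1) * (u x + deriv s 0) ^ 2 +
      (α + 1) * deriv (deriv s) 0) (cosMeasure α) := (hvi.const_mul _).add (hci _)
  rw [integral_add hsum hp.integrable_sq, integral_add (hvi.const_mul _) (hci _), integral_const_mul]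
  simp only [integral_const, smul_eq_mul] at hV2 ⊢
  set m := (cosMeasure α).real univ
  set A := ∫ x, (u x + deriv s 0) ^ 2 ∂(cosMeasure α)
  -- The second volume condition, divided by `2 + α`, eliminates `s''(0)`. The coefficient of `A` in
  -- `J''(0)` becomes `α(α+1) - (α+1)² = -(1+α)`.
  have hσ : m * deriv (deriv s) 0 = -((1 + α) * A) := by
    have : (2 + α) * (m * deriv (deriv s) 0 + (1 + α) * A) = 0 := by linarith
    rcases mul_eq_zero.1 this with h | h <;> linarith
  have : m * ((α + 1) * deriv (deriv s) 0) = (α + 1) * (-((1 + α) * A)) := by rw [← hσ]; ring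
  rw [this]
  linarith

theorem mainTheorem4 (α : ℝ) (hα : α ∈ Ioo (-1 : ℝ) 0) :
    (∀ u s : ℝ → ℝ,
      ContDiffOn ℝ 2 u (Ioo (-(π / 2)) (π / 2)) →
      MemLp (deriv u) 2 (cosMeasure α) →
      ContDiff ℝ 2 s → s 0 = 0 →
      (∃ t₀ > 0, ∀ t : ℝ, |t| < t₀ →
        weightedVolume 0 α (perturbedHalfDisc u s t) = weightedVolume 0 α halfDisc) →
      (∀ᶠ t in 𝓝 (0 : ℝ), weightedPerimeter 0 α (perturbedHalfDisc u s t) ≠ ⊤) ∧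
      (∀ᶠ t in 𝓝 (0 : ℝ), DifferentiableAt ℝ (perimeterFunctional 0 α u s) t) ∧
      DifferentiableAt ℝ (deriv (perimeterFunctional 0 α u s)) 0 ∧
      0 ≤ deriv (deriv (perimeterFunctional 0 α u s)) 0) ∧
    IsLeast (rayleighValues α) (1 + α) :=
  ⟨fun _ _ hu hp hs hs0 hvol => second_variation_halfDisc hα hu hp hs hs0 hvol,
    isLeast_rayleighValues hα⟩
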